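/- Let $M$ be a finite von Neumann algebra, let $N \subseteq Z(M)$ be a von Neumann subalgebra of its center (with the same unit), and let $E : M \to N$ be a normal, faithful, tracial conditional expectation, i.e. a positive linear map with $E(n)=n$, $E(nx)=nE(x)$, $E(xn)=E(x)n$ and $E(xy)=E(yx)$ for $n \in N$, $x,y \in M$, such that $E(x^*x)=0$ implies $x=0$, and such that $E$ preserves suprema of bounded increasing nets. Let $\mathcal{U} : N \to \mathbb{C}$ be a character, i.e. a unital (equivalently, nonzero) multiplicative linear functional. Put $$I_{E,\mathcal{U}} = \{x \in M : \mathcal{U}(E(x^*x)) = 0\},$$ a closed two-sided $*$-ideal of $M$, let $M^{/E,\mathcal{U}} = M/I_{E,\mathcal{U}}$ be the quotient $*$-algebra with the quotient norm (the ultrafiber of $M$), and let $\tau_{E,\mathcal{U}}(x + I_{E,\mathcal{U}}) = \mathcal{U}(E(x))$. Then $(M^{/E,\mathcal{U}}, \tau_{E,\mathcal{U}})$ is a tracial von Neumann algebra: $M^{/E,\mathcal{U}}$ is isometrically $*$-isomorphic to a von Neumann algebra of operators on some Hilbert space, and $\tau_{E,\mathcal{U}}$ is a faithful normal tracial state on it.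 Moreover, every element of norm $1$ in $M^{/E,\mathcal{U}}$ is the image of an element of norm $1$ in $M$ under the quotient map. -/

import Mathlib

open scoped ComplexOrder InnerProductSpace

universe u

namespace VonNeumannAlgebra

variable {H : Type u} [NormedAddCommGroup H] [InnerProductSpace ℂ H] [CompleteSpace H]

/-- A von Neumann algebra is finite if every isometry in it is a unitary. -/
def IsFinite (M : VonNeumannAlgebra H) : Prop :=
  ∀ v : M.toStarSubalgebra, star v * v = 1 → v * star v = 1

/-- A faithful normal tracial state on a von Neumann algebra. Positivity refers to the usual order
on operators. Normality is preservation of suprema of bounded increasing nets; for a positive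
linear map this is Scott continuity. -/
structure IsFaithfulNormalTracialState (M : VonNeumannAlgebra H)
    (τ : M.toStarSubalgebra →ₗ[ℂ] ℂ) : Prop where
  map_nonneg : ∀ x : M.toStarSubalgebra, 0 ≤ x → 0 ≤ τ x
  map_one : τ 1 = 1
  map_mul_comm : ∀ x y : M.toStarSubalgebra, τ (x * y) = τ (y * x)
  faithful : ∀ x : M.toStarSubalgebra, τ (star x * x) = 0 → x = 0
  normal : ScottContinuous τ

/-- `CentralExpectation M N`: the algebra `N` is a von Neumann subalgebra of the center of `M`,
together with a normal, faithful, tracial conditional expectation `E : M → N`. -/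
structure CentralExpectation (M N : VonNeumannAlgebra H) where
  /-- `N` is contained in `M`. -/
  le : N.toStarSubalgebra ≤ M.toStarSubalgebra
  /-- `N` commutes with `M`. -/
  central : ∀ (n : N.toStarSubalgebra) (x : M.toStarSubalgebra),
    (n : H →L[ℂ] H) * (x : H →L[ℂ] H) = (x : H →L[ℂ] H) * (n : H →L[ℂ] H)
  /-- The underlying linear map. -/
  toLinearMap : M.toStarSubalgebra →ₗ[ℂ] N.toStarSubalgebra
  map_nonneg : ∀ x : M.toStarSubalgebra, 0 ≤ x → 0 ≤ toLinearMap x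
  map_inclusion : ∀ n : N.toStarSubalgebra, toLinearMap (StarSubalgebra.inclusion le n) = n
  map_left_mul : ∀ (n : N.toStarSubalgebra) (x : M.toStarSubalgebra),
    toLinearMap (StarSubalgebra.inclusion le n * x) = n * toLinearMap x
  map_right_mul : ∀ (x : M.toStarSubalgebra) (n : N.toStarSubalgebra),
    toLinearMap (x * StarSubalgebra.inclusion le n) = toLinearMap x * n
  map_mul_comm : ∀ x y : M.toStarSubalgebra, toLinearMap (x * y) = toLinearMap (y * x)
  faithful : ∀ x : M.toStarSubalgebra, toLinearMap (star x * x) = 0 → x = 0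
  normal : ScottContinuous toLinearMap

end VonNeumannAlgebra

/-- A normed `*`-algebra `A` with a linear functional `τ` is a tracial von Neumann algebra if `A` is
isometrically `*`-isomorphic to a von Neumann algebra of operators on a Hilbert space, in such a way
that `τ` corresponds to a faithful normal tracial state. -/
def IsTracialVonNeumannAlgebra (A : Type u) [NormedRing A] [StarRing A] [NormedAlgebra ℂ A]
    (τ : A →ₗ[ℂ] ℂ) : Prop :=
  ∃ (K : Type u) (_ : NormedAddCommGroup K) (_ : InnerProductSpace ℂ K) (_ : CompleteSpace K)
    (S : VonNeumannAlgebra K) (Φ : A ≃⋆ₐ[ℂ] S.toStarSubalgebra) (τS : S.toStarSubalgebra →ₗ[ℂ] ℂ),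
    Isometry Φ ∧ S.IsFaithfulNormalTracialState τS ∧ ∀ a : A, τS (Φ a) = τ a

namespace VonNeumannAlgebra.CentralExpectation

variable {H : Type u} [NormedAddCommGroup H] [InnerProductSpace ℂ H] [CompleteSpace H]
  {M N : VonNeumannAlgebra H}

/-- The functional `x ↦ U (E x)` on `M`. -/
noncomputable def functional (E : CentralExpectation M N) (U : N.toStarSubalgebra →ₐ[ℂ] ℂ) :
    M.toStarSubalgebra →ₗ[ℂ] ℂ :=
  U.toLinearMap ∘ₗ E.toLinearMap

variable (E : CentralExpectation M N) (U : N.toStarSubalgebra →ₐ[ℂ] ℂ)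

theorem isClosed_coe (M : VonNeumannAlgebra H) :
    IsClosed (M.toStarSubalgebra : Set (H →L[ℂ] H)) := by
  have h := Set.isClosed_centralizer (Set.centralizer (M : Set (H →L[ℂ] H)))
  rwa [M.centralizer_centralizer] at h

theorem character_nonneg (n : N.toStarSubalgebra) (hn : 0 ≤ n) : 0 ≤ U n := by
  have : IsClosed (N.toStarSubalgebra : Set (H →L[ℂ] H)) := isClosed_coe N
  have h1 : U n ∈ spectrum ℂ n := AlgHom.apply_mem_spectrum U n
  rw [StarSubalgebra.spectrum_eq] at h1
  have h2 : (0 : H →L[ℂ] H) ≤ (n : H →L[ℂ] H) := hn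
  exact spectrum_nonneg_of_nonneg h2 h1

theorem functional_nonneg (x : M.toStarSubalgebra) (hx : 0 ≤ x) : 0 ≤ E.functional U x :=
  character_nonneg U _ (E.map_nonneg x hx)

theorem star_mul_self_nonneg' (x : M.toStarSubalgebra) : 0 ≤ star x * x := by
  change (0 : H →L[ℂ] H) ≤ star (x : H →L[ℂ] H) * (x : H →L[ℂ] H)
  exact star_mul_self_nonneg _

theorem functional_star_mul_self_nonneg (x : M.toStarSubalgebra) :
    0 ≤ E.functional U (star x * x) :=
  E.functional_nonneg U _ (star_mul_self_nonneg' x)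

theorem functional_one : E.functional U 1 = 1 := by
  have h := E.map_inclusion 1
  rw [_root_.map_one] at h
  simp [functional, h]

theorem functional_mul_comm (x y : M.toStarSubalgebra) :
    E.functional U (x * y) = E.functional U (y * x) := by
  simp [functional, E.map_mul_comm x y]

theorem eq_zero_of_forall_nonneg {w c : ℂ} (h : ∀ s : ℝ, 0 ≤ (s : ℂ) * w + c) : w = 0 := by
  have hre : ∀ s : ℝ, 0 ≤ s * w.re + c.re := fun s => by
    simpa using (Complex.le_def.1 (h s)).1
  have him : ∀ s : ℝ, 0 = s * w.im + c.im := fun s => by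
    simpa using (Complex.le_def.1 (h s)).2
  apply Complex.ext
  · by_contra hne
    have hne' : w.re ≠ 0 := hne
    have h1 := hre (-(c.re + 1) / w.re)
    rw [div_mul_cancel₀ _ hne'] at h1
    linarith
  · have h0 := him 0
    have h1 := him 1
    simp only [Complex.zero_im]
    linarith

/-- A form of the Cauchy-Schwarz inequality. -/
theorem functional_star_mul_eq_zero {x : M.toStarSubalgebra}
    (hx : E.functional U (star x * x) = 0) (y : M.toStarSubalgebra) :
    E.functional U (star y * x) = 0 := by
  have key : ∀ t : ℂ, 0 ≤ star t * E.functional U (star x * y) + t * E.functional U (star y * x)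
      + E.functional U (star y * y) := fun t => by
    have h := E.functional_star_mul_self_nonneg U (t • x + y)
    simp only [star_add, star_smul, add_mul, mul_add, smul_mul_assoc, mul_smul_comm, map_add,
      map_smul, hx, smul_eq_mul, mul_zero, zero_add] at h
    convert h using 1
    ring
  have h1 : E.functional U (star x * y) + E.functional U (star y * x) = 0 := by
    refine eq_zero_of_forall_nonneg (c := E.functional U (star y * y)) fun s => ?_
    have h := key s
    simp only [Complex.star_def, Complex.conj_ofReal] at h
    convert h using 1
    ring
  have h2 : Complex.I * (E.functional U (star y * x) - E.functional U (star x * y)) = 0 := by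
    refine eq_zero_of_forall_nonneg (c := E.functional U (star y * y)) fun s => ?_
    have h := key (s * Complex.I)
    simp only [Complex.star_def, map_mul, Complex.conj_ofReal, Complex.conj_I] at h
    convert h using 1
    ring
  have h3 := (mul_eq_zero.1 h2).resolve_left Complex.I_ne_zero
  linear_combination (1 / 2 : ℂ) * h1 + (1 / 2 : ℂ) * h3

/-- The ideal `I = {x ∈ M : U (E (x* x)) = 0}`. -/
noncomputable def ideal : Ideal M.toStarSubalgebra where
  carrier := {x | U (E.toLinearMap (star x * x)) = 0}
  zero_mem' := by simp
  add_mem' {x y} hx hy := by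
    change E.functional U (star (x + y) * (x + y)) = 0
    simp only [star_add, mul_add, map_add]
    simp only [add_mul, map_add, E.functional_star_mul_eq_zero U hx,
      E.functional_star_mul_eq_zero U hy, add_zero]
  smul_mem' a x hx := by
    change E.functional U (star (a * x) * (a * x)) = 0
    have h := E.functional_star_mul_eq_zero U hx (star a * (a * x))
    simpa [mul_assoc] using h

theorem mem_ideal {x : M.toStarSubalgebra} :
    x ∈ E.ideal U ↔ E.functional U (star x * x) = 0 := Iff.rfl

theorem star_mem_ideal {x : M.toStarSubalgebra} (hx : x ∈ E.ideal U) : star x ∈ E.ideal U := by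
  rw [mem_ideal, star_star, functional_mul_comm]
  exact hx

instance ideal_isTwoSided : (E.ideal U).IsTwoSided where
  mul_mem_of_left {x} a hx := by
    have h := (E.ideal U).mul_mem_left (star a) (E.star_mem_ideal U hx)
    simpa using E.star_mem_ideal U h

theorem functional_eq_zero {x : M.toStarSubalgebra} (hx : x ∈ E.ideal U) :
    E.functional U x = 0 := by
  simpa using E.functional_star_mul_eq_zero U hx 1

theorem functional_star_mul_self_le (x : M.toStarSubalgebra) :
    E.functional U (star x * x) ≤ ((‖x‖ ^ 2 : ℝ) : ℂ) := by
  have h : 0 ≤ algebraMap ℂ M.toStarSubalgebra ((‖x‖ ^ 2 : ℝ) : ℂ) - star x * x := by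
    change (0 : H →L[ℂ] H) ≤ algebraMap ℂ (H →L[ℂ] H) ((‖x‖ ^ 2 : ℝ) : ℂ)
      - star (x : H →L[ℂ] H) * (x : H →L[ℂ] H)
    rw [sub_nonneg]
    exact CStarAlgebra.star_mul_le_algebraMap_norm_sq
  have h1 := E.functional_nonneg U _ h
  rw [map_sub, Algebra.algebraMap_eq_smul_one, map_smul, functional_one, smul_eq_mul,
    mul_one, sub_nonneg] at h1
  exact h1

theorem isClosed_ideal : IsClosed (E.ideal U : Set M.toStarSubalgebra) := by
  refine isClosed_of_closure_subset fun x hx => ?_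
  rw [Metric.mem_closure_iff] at hx
  change E.functional U (star x * x) = 0
  have hle : ∀ y ∈ E.ideal U, E.functional U (star x * x) ≤ ((‖x - y‖ ^ 2 : ℝ) : ℂ) := by
    intro y hy
    have h := E.functional_star_mul_self_le U (x - y)
    have h1 : E.functional U (star y * x) = 0 := by
      rw [functional_mul_comm]
      simpa using E.functional_star_mul_eq_zero U (E.star_mem_ideal U hy) (star x)
    have h2 := E.functional_star_mul_eq_zero U hy x
    have h3 := E.functional_star_mul_eq_zero U hy y
    simpa only [star_sub, sub_mul, mul_sub, map_sub, h1, h2, h3, sub_zero] using h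
  have hnn := E.functional_star_mul_self_nonneg U x
  have hre : (E.functional U (star x * x)).re ≤ 0 := by
    refine le_of_forall_pos_le_add fun ε hε => ?_
    obtain ⟨y, hy, hd⟩ := hx (Real.sqrt ε) (Real.sqrt_pos.2 hε)
    have h := (Complex.le_def.1 (hle y hy)).1
    rw [Complex.ofReal_re] at h
    rw [dist_eq_norm] at hd
    have h4 := pow_le_pow_left₀ (norm_nonneg _) hd.le 2
    rw [Real.sq_sqrt hε.le] at h4
    linarith
  have h0 := Complex.le_def.1 hnn
  exact Complex.ext (le_antisymm hre h0.1) h0.2.symm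

/-- The ultrafiber of `M` with respect to `E` and `U`: the quotient of `M` by the ideal
`I = {x ∈ M : U (E (x* x)) = 0}`. -/
def Ultrafiber : Type u := M.toStarSubalgebra ⧸ E.ideal U

namespace Ultrafiber

noncomputable instance instRing : Ring (E.Ultrafiber U) :=
  inferInstanceAs (Ring (M.toStarSubalgebra ⧸ E.ideal U))

noncomputable instance instAlgebra : Algebra ℂ (E.Ultrafiber U) :=
  inferInstanceAs (Algebra ℂ (M.toStarSubalgebra ⧸ E.ideal U))

/-- The quotient map, as a homomorphism of algebras. -/
noncomputable def mkₐ : M.toStarSubalgebra →ₐ[ℂ] E.Ultrafiber U :=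
  Ideal.Quotient.mkₐ ℂ (E.ideal U)

theorem mkₐ_surjective : Function.Surjective (mkₐ E U) := Ideal.Quotient.mk_surjective

theorem mkₐ_eq_zero_iff {x : M.toStarSubalgebra} : mkₐ E U x = 0 ↔ x ∈ E.ideal U :=
  Ideal.Quotient.eq_zero_iff_mem

/-- The quotient norm `‖x + I‖ = inf {‖x - i‖ : i ∈ I}`. -/
noncomputable instance instNormedAddCommGroup : NormedAddCommGroup (E.Ultrafiber U) :=
  have : IsClosed (E.ideal U : Set M.toStarSubalgebra) := E.isClosed_ideal U
  { Submodule.Quotient.normedAddCommGroup (E.ideal U),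
    instRing E U with }

theorem norm_mkₐ_le (x : M.toStarSubalgebra) : ‖mkₐ E U x‖ ≤ ‖x‖ :=
  Submodule.Quotient.norm_mk_le (E.ideal U) x

theorem exists_norm_lt (a : E.Ultrafiber U) {ε : ℝ} (hε : 0 < ε) :
    ∃ x, mkₐ E U x = a ∧ ‖x‖ < ‖a‖ + ε :=
  Submodule.Quotient.norm_mk_lt (S := E.ideal U) a hε

theorem norm_eq_infDist (x : M.toStarSubalgebra) :
    ‖mkₐ E U x‖ = Metric.infDist x (E.ideal U : Set M.toStarSubalgebra) :=
  QuotientAddGroup.norm_mk x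

noncomputable instance instNormedRing : NormedRing (E.Ultrafiber U) where
  toRing := instRing E U
  __ := instNormedAddCommGroup E U
  norm_mul_le a b := by
    have key : ∀ ε : ℝ, 0 < ε → ‖a * b‖ ≤ (‖a‖ + ε) * (‖b‖ + ε) := fun ε hε => by
      obtain ⟨x, rfl, hx⟩ := exists_norm_lt E U a hε
      obtain ⟨y, rfl, hy⟩ := exists_norm_lt E U b hε
      rw [← map_mul]
      calc _ ≤ ‖x * y‖ := norm_mkₐ_le E U _
        _ ≤ ‖x‖ * ‖y‖ := norm_mul_le _ _
        _ ≤ _ := by gcongr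
    have ht : Filter.Tendsto (fun ε : ℝ => (‖a‖ + ε) * (‖b‖ + ε)) (nhdsWithin 0 (Set.Ioi 0))
        (nhds (‖a‖ * ‖b‖)) := by
      have hc : Continuous fun ε : ℝ => (‖a‖ + ε) * (‖b‖ + ε) := by fun_prop
      simpa using (hc.tendsto 0).mono_left nhdsWithin_le_nhds
    exact ge_of_tendsto ht (eventually_nhdsWithin_of_forall fun ε hε => key ε hε)

noncomputable instance instNormedAlgebra : NormedAlgebra ℂ (E.Ultrafiber U) where
  toAlgebra := instAlgebra E U
  norm_smul_le c a := by
    refine le_of_forall_pos_le_add fun ε hε => ?_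
    have hpos : 0 < ‖c‖ + 1 := by positivity
    obtain ⟨x, rfl, hx⟩ := exists_norm_lt E U a (div_pos hε hpos)
    rw [← map_smul]
    calc _ ≤ ‖c • x‖ := norm_mkₐ_le E U _
      _ = ‖c‖ * ‖x‖ := norm_smul _ _
      _ ≤ ‖c‖ * (‖mkₐ E U x‖ + ε / (‖c‖ + 1)) := by gcongr
      _ = ‖c‖ * ‖mkₐ E U x‖ + ‖c‖ / (‖c‖ + 1) * ε := by ring
      _ ≤ ‖c‖ * ‖mkₐ E U x‖ + 1 * ε := by
        gcongr
        rw [div_le_one hpos]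
        linarith
      _ = _ := by ring

theorem mkₐ_star_eq {x y : M.toStarSubalgebra} (h : mkₐ E U x = mkₐ E U y) :
    mkₐ E U (star x) = mkₐ E U (star y) := by
  rw [← sub_eq_zero, ← map_sub, mkₐ_eq_zero_iff] at h ⊢
  rw [← star_sub]
  exact E.star_mem_ideal U h

/-- The involution `(x + I)* = x* + I`. -/
noncomputable instance instStar : Star (E.Ultrafiber U) where
  star a := mkₐ E U (star (mkₐ_surjective E U a).choose)

theorem star_mkₐ (x : M.toStarSubalgebra) : star (mkₐ E U x) = mkₐ E U (star x) :=
  mkₐ_star_eq E U (mkₐ_surjective E U (mkₐ E U x)).choose_spec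

noncomputable instance instStarRing : StarRing (E.Ultrafiber U) where
  star_involutive a := by
    obtain ⟨x, rfl⟩ := mkₐ_surjective E U a
    rw [star_mkₐ, star_mkₐ, star_star]
  star_mul a b := by
    obtain ⟨x, rfl⟩ := mkₐ_surjective E U a
    obtain ⟨y, rfl⟩ := mkₐ_surjective E U b
    rw [← map_mul, star_mkₐ, star_mkₐ, star_mkₐ, star_mul, map_mul]
  star_add a b := by
    obtain ⟨x, rfl⟩ := mkₐ_surjective E U a
    obtain ⟨y, rfl⟩ := mkₐ_surjective E U b
    rw [← map_add, star_mkₐ, star_mkₐ, star_mkₐ, star_add, map_add]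

/-- The quotient map `M → M ⧸ I`, as a `*`-homomorphism. -/
noncomputable def mk : M.toStarSubalgebra →⋆ₐ[ℂ] E.Ultrafiber U where
  __ := mkₐ E U
  map_star' x := (star_mkₐ E U x).symm

/-- The functional `x + I ↦ U (E x)` on the ultrafiber. -/
noncomputable def trace : E.Ultrafiber U →ₗ[ℂ] ℂ :=
  ((E.ideal U).restrictScalars ℂ).liftQ (E.functional U) fun _ hx => E.functional_eq_zero U hx

theorem trace_mk (x : M.toStarSubalgebra) : trace E U (mk E U x) = U (E.toLinearMap x) := rfl

end Ultrafiber

end VonNeumannAlgebra.CentralExpectation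

/-! Write `f = U ∘ E`, a tracial state on `M`. The ultrafiber is `M` modulo the kernel of the GNS
representation of `f`, so it suffices that the GNS image is a von Neumann algebra and that each of
its elements lifts to `M` without increase of norm. Both follow from `exists_gnsStarAlgHom_eq`:
every `T` commuting with the right multiplications is the image of some `x` with `‖x‖ ≤ ‖T‖`.

For a contraction `T` of this kind, `mem_closure_gnsVec_closedBall` puts `T 1` in the 2-norm closure
of the unit ball of `M`, by Hahn-Banach separation and an approximate polar decomposition. It
remains to see that the image of the ball is already closed (`isClosed_gnsVec_closedBall`).

The difficulty there is that `U` need not be normal, so a strong limit in `M` says nothing at `U`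
without uniform control. Given a sequence that is Cauchy fast at `U`, `exists_uniformly_close`
changes each term within its class, by a cutoff in `N`, until consecutive terms are close in the
`N`-valued 2-norm of `E`. Then `exists_egorov` gives operators `w k`, with `E (w k)` small in norm,
away from which convergence is uniform. Faithfulness of `E` makes `w k` tend strongly to zero, so
the sequence has a strong limit in the ball. The bound on `E (w k)` makes it a limit in the 2-norm
of `f` too. -/

/-! ### Approximate polar decomposition -/

section Factorization

variable {A : Type*} [CStarAlgebra A] [PartialOrder A] [StarOrderedRing A]

/-- An approximate polar decomposition `y = w c²`, with `b = w c`. -/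
theorem CStarAlgebra.exists_approx_polar (y : A) {δ : ℝ} (hδ : 0 < δ) :
    ∃ b c w : A, b * c = y ∧ star c = c ∧ w * c = b ∧ ‖w‖ ≤ 1 ∧
      c * c ≤ star b * b + algebraMap ℝ A δ := by
  set p := star y * y with hp
  have hp0 : 0 ≤ p := star_mul_self_nonneg y
  have hsp : ∀ t ∈ spectrum ℝ p, 0 ≤ t := fun t ht => spectrum_nonneg_of_nonneg hp0 ht
  have hsa : IsSelfAdjoint p := hp0.isSelfAdjoint
  -- With `c = (δ² + p)^(1/4)`, `b = y c⁻¹` and `w = y c⁻²`, one gets `w* w = p / (δ² + p) ≤ 1` and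
  -- `c² - b* b = δ² / √(δ² + p) ≤ δ`.
  let u : ℝ → ℝ := fun t => √(√(δ ^ 2 + t))
  have hu : Continuous u := by fun_prop
  have hupos : ∀ t ∈ spectrum ℝ p, 0 < u t := fun t ht => by
    have := hsp t ht
    exact Real.sqrt_pos.2 (Real.sqrt_pos.2 (by positivity))
  have hv : ContinuousOn (fun t => (u t)⁻¹) (spectrum ℝ p) :=
    hu.continuousOn.inv₀ fun t ht => (hupos t ht).ne'
  have hu4 : ∀ t ∈ spectrum ℝ p, u t ^ 4 = δ ^ 2 + t := fun t ht => by
    have := hsp t ht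
    have h2 : u t ^ 2 = √(δ ^ 2 + t) := Real.sq_sqrt (Real.sqrt_nonneg _)
    calc u t ^ 4 = (u t ^ 2) ^ 2 := by ring
      _ = _ := by rw [h2, Real.sq_sqrt (by positivity)]
  have hu2 : ∀ t ∈ spectrum ℝ p, δ ≤ u t ^ 2 := fun t ht => by
    have h := hu4 t ht
    have := hsp t ht
    by_contra! hc
    nlinarith [sq_nonneg (u t)]
  let c := cfc u p
  let d := cfc (fun t => (u t)⁻¹) p
  have hc : star c = c := (cfc_predicate u p : IsSelfAdjoint _)
  have hd : star d = d := (cfc_predicate (fun t => (u t)⁻¹) p : IsSelfAdjoint _)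
  have hdc : d * c = 1 := by
    rw [← cfc_mul _ _ p hv hu.continuousOn, ← cfc_one ℝ p]
    exact cfc_congr fun t ht => inv_mul_cancel₀ (hupos t ht).ne'
  have hdpd : d * p * d = cfc (fun t => (u t)⁻¹ * t * (u t)⁻¹) p := by
    rw [cfc_mul (fun t => (u t)⁻¹ * t) _ p (hv.mul continuousOn_id) hv,
      cfc_mul _ (fun t => t) p hv continuousOn_id, cfc_id' ℝ p]
  refine ⟨y * d, c, y * d * d, by rw [mul_assoc, hdc, mul_one], hc,
    by rw [mul_assoc, hdc, mul_one], ?_, ?_⟩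
  · have h1 : star (y * d * d) * (y * d * d) = d * (d * p * d) * d := by
      simp only [star_mul, hd, hp, mul_assoc]
    have h2 : ‖d * (d * p * d) * d‖ ≤ 1 := by
      rw [hdpd, ← cfc_mul _ _ p hv (by fun_prop), ← cfc_mul _ _ p (by fun_prop) hv]
      refine norm_cfc_le zero_le_one fun t ht => ?_
      have h3 := hupos t ht
      have h0 := hsp t ht
      rw [Real.norm_of_nonneg (by positivity)]
      have : (u t)⁻¹ * ((u t)⁻¹ * t * (u t)⁻¹) * (u t)⁻¹ = t / u t ^ 4 := by
        field_simp
      rw [this, hu4 t ht, div_le_one (by positivity)]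
      nlinarith
    rw [← h1, CStarRing.norm_star_mul_self] at h2
    nlinarith [norm_nonneg (y * d * d)]
  · have h1 : star (y * d) * (y * d) = d * p * d := by
      simp only [star_mul, hd, hp, mul_assoc]
    rw [h1, hdpd, ← cfc_mul _ _ p hu.continuousOn hu.continuousOn,
      ← cfc_add_const _ _ p (by fun_prop)]
    refine cfc_mono (fun t ht => ?_) (by fun_prop) (by fun_prop)
    have h3 := hupos t ht
    have h4 := hu4 t ht
    have h5 := hu2 t ht
    have : (u t)⁻¹ * t * (u t)⁻¹ = t / u t ^ 2 := by field_simp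
    rw [this, ← sub_le_iff_le_add, le_div_iff₀ (by positivity)]
    nlinarith

end Factorization

/-! ### GNS space of a trace: left and right multiplications -/

namespace PositiveLinearMap

open UniformSpace

variable {A : Type*} [CStarAlgebra A] [PartialOrder A] [StarOrderedRing A] (f : A →ₚ[ℂ] ℂ)

/-- The canonical map from a C⋆-algebra to the GNS space. -/
noncomputable def gnsVec : A →ₗ[ℂ] f.GNS :=
  (Completion.toComplL : f.PreGNS →L[ℂ] f.GNS).toLinearMap ∘ₗ f.toPreGNS.toLinearMap

theorem gnsVec_apply (a : A) : f.gnsVec a = (f.toPreGNS a : f.GNS) := rfl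

theorem inner_gnsVec (a b : A) : ⟪f.gnsVec a, f.gnsVec b⟫_ℂ = f (star a * b) := by
  simp [gnsVec_apply, preGNS_inner_def]

theorem norm_gnsVec_sq (a : A) : ‖f.gnsVec a‖ ^ 2 = (f (star a * a)).re := by
  rw [← inner_gnsVec, inner_self_eq_norm_sq_to_K]
  norm_cast

theorem gnsStarAlgHom_gnsVec (a b : A) : f.gnsStarAlgHom a (f.gnsVec b) = f.gnsVec (a * b) := by
  simp [gnsVec_apply]

theorem denseRange_gnsVec : DenseRange f.gnsVec :=
  Completion.denseRange_coe.comp f.toPreGNS.surjective.denseRange (Completion.continuous_coe _)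

theorem norm_gnsStarAlgHom_le (a : A) : ‖f.gnsStarAlgHom a‖ ≤ ‖a‖ :=
  NonUnitalStarAlgHom.norm_apply_le f.gnsStarAlgHom a

theorem norm_gnsVec_le (hf1 : f 1 = 1) (a : A) : ‖f.gnsVec a‖ ≤ ‖a‖ := by
  have h1 : ‖f.gnsVec 1‖ = 1 := by
    have h := f.norm_gnsVec_sq 1
    simp only [star_one, mul_one, hf1, Complex.one_re] at h
    exact (pow_eq_one_iff_of_nonneg (norm_nonneg _) two_ne_zero).1 h
  have h := (f.gnsStarAlgHom a).le_of_opNorm_le (f.norm_gnsStarAlgHom_le a) (f.gnsVec 1)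
  rwa [gnsStarAlgHom_gnsVec, mul_one, h1, mul_one] at h

variable (hf : ∀ x y, f (x * y) = f (y * x))

-- Traciality makes the involution isometric in the 2-norm, which is what makes right multiplication
-- bounded.
include hf in
theorem norm_gnsVec_star (a : A) : ‖f.gnsVec (star a)‖ = ‖f.gnsVec a‖ := by
  have h : ‖f.gnsVec (star a)‖ ^ 2 = ‖f.gnsVec a‖ ^ 2 := by
    rw [norm_gnsVec_sq, norm_gnsVec_sq, star_star, hf]
  exact (pow_left_inj₀ (norm_nonneg _) (norm_nonneg _) two_ne_zero).1 h

/-- Right multiplication on the pre-GNS space of a trace. -/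
noncomputable def rightMulMapPreGNS (a : A) : f.PreGNS →L[ℂ] f.PreGNS :=
  (f.toPreGNS.toLinearMap ∘ₗ LinearMap.mulRight ℂ a ∘ₗ f.ofPreGNS.toLinearMap).mkContinuous ‖a‖
    fun x => by
      -- Since `x a = (a* x*)*`, the bound is inherited from left multiplication by `a*`.
      have h := (f.gnsStarAlgHom (star a)).le_of_opNorm_le (f.norm_gnsStarAlgHom_le _)
        (f.gnsVec (star (f.ofPreGNS x)))
      rw [gnsStarAlgHom_gnsVec, ← star_mul, norm_gnsVec_star f hf, norm_gnsVec_star f hf,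
        norm_star, gnsVec_apply, gnsVec_apply, Completion.norm_coe, Completion.norm_coe] at h
      exact h

/-- Right multiplication on the GNS space of a trace. -/
noncomputable def gnsRightMul (a : A) : f.GNS →L[ℂ] f.GNS :=
  (f.rightMulMapPreGNS hf a).completion

theorem gnsRightMul_gnsVec (a b : A) : f.gnsRightMul hf a (f.gnsVec b) = f.gnsVec (b * a) := by
  rw [gnsRightMul, gnsVec_apply, ContinuousLinearMap.completion_apply_coe]
  rfl

theorem star_gnsRightMul (a : A) : star (f.gnsRightMul hf a) = f.gnsRightMul hf (star a) := by
  symm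
  refine (ContinuousLinearMap.eq_adjoint_iff _ _).2 fun x y => ?_
  refine f.denseRange_gnsVec.induction_on₂ (isClosed_eq (by fun_prop) (by fun_prop))
    (fun b c => ?_) x y
  simp only [gnsRightMul_gnsVec, inner_gnsVec, star_mul, star_star]
  rw [mul_assoc, hf, mul_assoc]

theorem gnsRightMul_mul_gnsStarAlgHom (a b : A) :
    f.gnsRightMul hf a * f.gnsStarAlgHom b = f.gnsStarAlgHom b * f.gnsRightMul hf a := by
  ext x
  refine f.denseRange_gnsVec.induction_on x (isClosed_eq (by fun_prop) (by fun_prop)) fun c => ?_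
  simp only [mul_apply_eq_comp, gnsRightMul_gnsVec, gnsStarAlgHom_gnsVec, mul_assoc]

/-- The vector of `1` is cyclic for the right multiplications, hence separating for their commutant.
-/
theorem eq_of_gnsVec_one_eq {S T : f.GNS →L[ℂ] f.GNS}
    (hS : ∀ a, S * f.gnsRightMul hf a = f.gnsRightMul hf a * S)
    (hT : ∀ a, T * f.gnsRightMul hf a = f.gnsRightMul hf a * T)
    (h : S (f.gnsVec 1) = T (f.gnsVec 1)) : S = T := by
  ext x
  refine f.denseRange_gnsVec.induction_on x (isClosed_eq (by fun_prop) (by fun_prop)) fun c => ?_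
  have h1 := congr($(hS c) (f.gnsVec 1))
  have h2 := congr($(hT c) (f.gnsVec 1))
  simp only [mul_apply_eq_comp, gnsRightMul_gnsVec, one_mul] at h1 h2
  rw [h1, h2, h]

/-! ### Contractions in the commutant are 2-norm limits of contractions -/

section Separation

variable {f} (hf1 : f 1 = 1) {T : f.GNS →L[ℂ] f.GNS} (hT1 : ‖T‖ ≤ 1)
  (hT : ∀ a, T * f.gnsRightMul hf a = f.gnsRightMul hf a * T)

include hf1 hT1 hT

/-- Take `y = b c` and `w` from the approximate polar decomposition. As `T` commutes with right
multiplication by `c`, `⟪y, T 1⟫ = ⟪b, T c⟫`, of real part at most `‖b‖ ‖c‖ ≤ (‖b‖² + ‖c‖²) / 2 ≤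
‖b‖² + δ`, while the trace property gives `⟪y, w⟫ = ‖b‖²`. -/
theorem exists_re_inner_gnsVec_le (y : A) {δ : ℝ} (hδ : 0 < δ) :
    ∃ w : A, ‖w‖ ≤ 1 ∧ (⟪f.gnsVec y, T (f.gnsVec 1)⟫_ℂ).re
      ≤ (⟪f.gnsVec y, f.gnsVec w⟫_ℂ).re + δ := by
  obtain ⟨b, c, w, rfl, hc, hb, hw, hle⟩ := CStarAlgebra.exists_approx_polar y hδ
  refine ⟨w, hw, ?_⟩
  have h1 : ⟪f.gnsVec (b * c), T (f.gnsVec 1)⟫_ℂ = ⟪f.gnsVec b, T (f.gnsVec c)⟫_ℂ := by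
    have h2 := congr($(hT c) (f.gnsVec 1))
    simp only [mul_apply_eq_comp, gnsRightMul_gnsVec, one_mul] at h2
    rw [h2, ← f.gnsRightMul_gnsVec hf, ← ContinuousLinearMap.adjoint_inner_right,
      ← ContinuousLinearMap.star_eq_adjoint, star_gnsRightMul, hc]
  have h3 : (⟪f.gnsVec (b * c), f.gnsVec w⟫_ℂ).re = ‖f.gnsVec b‖ ^ 2 := by
    rw [inner_gnsVec, norm_gnsVec_sq, star_mul, hc, mul_assoc, hf, mul_assoc, hb]
  have h4 : ‖f.gnsVec c‖ ^ 2 ≤ ‖f.gnsVec b‖ ^ 2 + δ := by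
    rw [norm_gnsVec_sq, norm_gnsVec_sq, hc]
    have h5 := OrderHomClass.mono f hle
    have h6 : f (algebraMap ℝ A δ) = (δ : ℂ) := by
      rw [IsScalarTower.algebraMap_apply ℝ ℂ A, Algebra.algebraMap_eq_smul_one, map_smul, hf1]
      simp
    rw [map_add, h6] at h5
    simpa using (Complex.le_def.1 h5).1
  rw [h1, h3]
  have h7 : ‖T (f.gnsVec c)‖ ≤ ‖f.gnsVec c‖ := by
    simpa using T.le_of_opNorm_le hT1 (f.gnsVec c)
  calc _ ≤ ‖f.gnsVec b‖ * ‖T (f.gnsVec c)‖ := re_inner_le_norm (𝕜 := ℂ) _ _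
    _ ≤ ‖f.gnsVec b‖ * ‖f.gnsVec c‖ := by gcongr
    _ ≤ _ := by nlinarith [sq_nonneg (‖f.gnsVec b‖ - ‖f.gnsVec c‖)]

theorem mem_closure_gnsVec_closedBall :
    T (f.gnsVec 1) ∈ closure (f.gnsVec '' Metric.closedBall 0 1) := by
  by_contra hmem
  have hconv : Convex ℝ (closure (f.gnsVec '' Metric.closedBall (0 : A) 1)) :=
    ((convex_closedBall (0 : A) 1).linear_image (f.gnsVec.restrictScalars ℝ)).closure
  obtain ⟨φ, u, hφ, hu⟩ := RCLike.geometric_hahn_banach_closed_point (𝕜 := ℂ) hconv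
    isClosed_closure hmem
  set η := (InnerProductSpace.toDual ℂ f.GNS).symm φ with hη
  have hφη : ∀ x, φ x = ⟪η, x⟫_ℂ := fun x => by simp [hη]
  set δ := (φ (T (f.gnsVec 1))).re - u with hδ
  have hδ0 : 0 < δ := sub_pos.2 hu
  obtain ⟨y, hy⟩ := f.denseRange_gnsVec.exists_dist_lt η (show 0 < δ / 4 by positivity)
  obtain ⟨w, hw, hle⟩ := exists_re_inner_gnsVec_le hf hf1 hT1 hT y (show 0 < δ / 4 by positivity)
  have hwu : (φ (f.gnsVec w)).re < u := hφ _ (subset_closure ⟨w, by simpa using hw, rfl⟩)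
  have h1 : ‖f.gnsVec 1‖ ≤ 1 := by
    have h := f.norm_gnsVec_sq 1
    simp only [star_one, mul_one, hf1, Complex.one_re] at h
    nlinarith [norm_nonneg (f.gnsVec 1)]
  have h2 : ‖T (f.gnsVec 1)‖ ≤ 1 := by
    calc _ ≤ 1 * ‖f.gnsVec 1‖ := T.le_of_opNorm_le hT1 _
      _ ≤ 1 := by simpa using h1
  have h3 : ‖f.gnsVec w‖ ≤ 1 := (f.norm_gnsVec_le hf1 w).trans hw
  rw [dist_eq_norm] at hy
  -- Replacing `η` by `y` costs at most `δ / 2`, and `w` loses `δ / 4` more. The total is below the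
  -- separation gap `δ`.
  have h4 : (⟪η - f.gnsVec y, T (f.gnsVec 1) - f.gnsVec w⟫_ℂ).re ≤ δ / 4 * 2 :=
    calc _ ≤ ‖η - f.gnsVec y‖ * ‖T (f.gnsVec 1) - f.gnsVec w‖ := re_inner_le_norm (𝕜 := ℂ) _ _
      _ ≤ δ / 4 * 2 := by
        gcongr
        exact (norm_sub_le _ _).trans (by linarith)
  simp only [inner_sub_left, inner_sub_right, ← hφη, Complex.sub_re] at h4
  linarith

end Separation

end PositiveLinearMap

/-! ### Monotone nets, strong limits and order -/

section Order

open Filter Topology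

variable {H : Type u} [NormedAddCommGroup H] [InnerProductSpace ℂ H] [CompleteSpace H]

omit [CompleteSpace H] in
theorem ContinuousLinearMap.le_iff_forall_inner_le {S T : H →L[ℂ] H} :
    S ≤ T ↔ ∀ ξ, ⟪ξ, S ξ⟫_ℂ ≤ ⟪ξ, T ξ⟫_ℂ := by
  rw [ContinuousLinearMap.le_def, ContinuousLinearMap.isPositive_iff_complex]
  refine forall_congr' fun ξ => ?_
  rw [← sub_nonneg (b := ⟪ξ, S ξ⟫_ℂ), ← inner_sub_right, ← sub_apply,
    ← inner_conj_symm ξ, Complex.le_def]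
  generalize ⟪(T - S) ξ, ξ⟫_ℂ = z
  simp [Complex.ext_iff, eq_comm, and_comm]

/-- Conjugating `S ≤ ‖S‖` by `√S` gives `S² ≤ ‖S‖ S`. This upgrades convergence of quadratic forms
to strong convergence. -/
theorem ContinuousLinearMap.norm_apply_sq_le_of_nonneg {S : H →L[ℂ] H} (hS : 0 ≤ S) (ξ : H) :
    ‖S ξ‖ ^ 2 ≤ ‖S‖ * (⟪ξ, S ξ⟫_ℂ).re := by
  have hsa : star S = S := hS.isSelfAdjoint
  have h : S * S ≤ ‖S‖ • S := by
    have h1 := CStarAlgebra.star_left_conjugate_le_norm_smul (a := CFC.sqrt S) (b := S)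
    have h2 : star (CFC.sqrt S) = CFC.sqrt S := (CFC.sqrt_nonneg S).isSelfAdjoint
    have h3 : CFC.sqrt S * CFC.sqrt S = S := CFC.sqrt_mul_sqrt_self S
    have h4 : CFC.sqrt S * S * CFC.sqrt S = S * S := by
      conv_lhs => enter [1, 2]; rw [← h3]
      rw [mul_assoc, mul_assoc, h3, ← mul_assoc, h3]
    rwa [h2, h3, h4] at h1
  have h1 := (Complex.le_def.1 (ContinuousLinearMap.le_iff_forall_inner_le.1 h ξ)).1
  have h2 : ⟪ξ, (S * S) ξ⟫_ℂ = ((‖S ξ‖ ^ 2 : ℝ) : ℂ) := by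
    rw [mul_apply_eq_comp]
    conv_lhs => enter [3]; rw [← hsa]
    rw [ContinuousLinearMap.star_eq_adjoint, ContinuousLinearMap.adjoint_inner_right,
      ← ContinuousLinearMap.star_eq_adjoint, hsa, inner_self_eq_norm_sq_to_K]
    norm_cast
  rw [h2, Complex.ofReal_re] at h1
  simpa using h1

namespace VonNeumannAlgebra

variable (M : VonNeumannAlgebra H)

/-- A strong limit still commutes with the commutant, so it lies in the bicommutant. -/
theorem mem_of_tendsto {ι : Type*} {l : Filter ι} [l.NeBot] {F : ι → M.toStarSubalgebra}
    {T : H →L[ℂ] H} (h : ∀ ξ, Tendsto (fun i => (F i : H →L[ℂ] H) ξ) l (𝓝 (T ξ))) :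
    T ∈ M.toStarSubalgebra := by
  rw [mem_carrier, ← M.centralizer_centralizer]
  intro g hg
  ext ξ
  have h1 : ∀ i, g ((F i : H →L[ℂ] H) ξ) = (F i : H →L[ℂ] H) (g ξ) := fun i =>
    congr($((hg (F i) (F i).2).symm) ξ)
  have h2 := (g.continuous.tendsto _).comp (h ξ)
  refine tendsto_nhds_unique h2 ?_
  simpa only [Function.comp_def, h1, mul_apply_eq_comp] using h (g ξ)

variable {M}

theorem le_iff_forall_inner_le {x y : M.toStarSubalgebra} :
    x ≤ y ↔ ∀ ξ, ⟪ξ, (x : H →L[ℂ] H) ξ⟫_ℂ ≤ ⟪ξ, (y : H →L[ℂ] H) ξ⟫_ℂ := by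
  rw [← ContinuousLinearMap.le_iff_forall_inner_le]
  rfl

theorem norm_sub_le_of_le {a₀ x y b : M.toStarSubalgebra} (h0 : a₀ ≤ x) (hxy : x ≤ y)
    (hb : y ≤ b) : ‖(y : H →L[ℂ] H) - x‖ ≤ ‖(b : H →L[ℂ] H) - a₀‖ :=
  CStarAlgebra.norm_le_norm_of_nonneg_of_le
    (sub_nonneg.2 (show (x : H →L[ℂ] H) ≤ y from hxy))
    (sub_le_sub (show (y : H →L[ℂ] H) ≤ b from hb) (show (a₀ : H →L[ℂ] H) ≤ x from h0))

theorem exists_tendsto_apply {d : Set M.toStarSubalgebra} (hne : d.Nonempty)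
    (hd : DirectedOn (· ≤ ·) d) (hb : BddAbove d) (ξ : H) :
    ∃ η, Tendsto (fun a : d => (a : H →L[ℂ] H) ξ) atTop (𝓝 η) := by
  obtain ⟨b, hb⟩ := hb
  obtain ⟨a₀, ha₀⟩ := hne
  have : Nonempty d := ⟨⟨a₀, ha₀⟩⟩
  have : IsDirectedOrder d := ⟨directedOn_iff_directed.1 hd⟩
  set B : H →L[ℂ] H := b - a₀ with hB
  rw [← cauchy_map_iff_exists_tendsto, Metric.cauchy_iff]
  refine ⟨inferInstance, fun ε hε => ?_⟩
  let q : d → ℝ := fun a => (⟪ξ, (a : H →L[ℂ] H) ξ⟫_ℂ).re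
  have hq : Monotone q := fun x y hxy => (Complex.le_def.1 (le_iff_forall_inner_le.1 hxy ξ)).1
  have hqb : BddAbove (Set.range q) := ⟨(⟪ξ, (b : H →L[ℂ] H) ξ⟫_ℂ).re, by
    rintro _ ⟨x, rfl⟩
    exact (Complex.le_def.1 (le_iff_forall_inner_le.1 (hb x.2) ξ)).1⟩
  -- Beyond `a₂` the quadratic form at `ξ` varies by at most `ε'`, so the vectors vary by less than
  -- `√((‖B‖ + 1) ε') = ε / 2`.
  set ε' := (ε / 2) ^ 2 / (‖B‖ + 1) with hε'
  have hε'0 : 0 < ε' := by positivity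
  obtain ⟨a₁, ha₁⟩ := exists_lt_of_lt_ciSup (sub_lt_self (⨆ x, q x) hε'0)
  obtain ⟨a₂, h02, h12⟩ := exists_ge_ge (⟨a₀, ha₀⟩ : d) a₁
  have hdist : ∀ a : d, a₂ ≤ a → dist ((a : H →L[ℂ] H) ξ) ((a₂ : H →L[ℂ] H) ξ) < ε / 2 := by
    intro a ha
    rw [dist_eq_norm, ← sub_apply]
    refine lt_of_pow_lt_pow_left₀ 2 (by positivity) ?_
    have h1 : (⟪ξ, ((a : H →L[ℂ] H) - a₂) ξ⟫_ℂ).re ≤ ε' := by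
      have h2 : (⟪ξ, ((a : H →L[ℂ] H) - a₂) ξ⟫_ℂ).re = q a - q a₂ := by
        simp only [q, sub_apply, inner_sub_right, Complex.sub_re]
      have := hq h12
      have := le_ciSup hqb a
      linarith
    calc _ ≤ ‖(a : H →L[ℂ] H) - a₂‖ * (⟪ξ, ((a : H →L[ℂ] H) - a₂) ξ⟫_ℂ).re :=
          ContinuousLinearMap.norm_apply_sq_le_of_nonneg (sub_nonneg.2 (show (a₂ : H →L[ℂ] H) ≤ a from ha)) ξ
      _ ≤ ‖(a : H →L[ℂ] H) - a₂‖ * ε' := by gcongr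
      _ ≤ ‖B‖ * ε' := by gcongr; exact norm_sub_le_of_le h02 ha (hb a.2)
      _ < (‖B‖ + 1) * ε' := by gcongr; linarith
      _ = _ := by rw [hε']; field_simp
  refine ⟨_, image_mem_map (Ici_mem_atTop a₂), ?_⟩
  rintro _ ⟨x, hx, rfl⟩ _ ⟨y, hy, rfl⟩
  have h1 := dist_triangle_right ((x : H →L[ℂ] H) ξ) ((y : H →L[ℂ] H) ξ) ((a₂ : H →L[ℂ] H) ξ)
  linarith [hdist x hx, hdist y hy]

/-- Bounded increasing nets in a von Neumann algebra converge strongly to their supremum. -/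
theorem exists_isLUB_tendsto {d : Set M.toStarSubalgebra} (hne : d.Nonempty)
    (hd : DirectedOn (· ≤ ·) d) (hb : BddAbove d) :
    ∃ T : M.toStarSubalgebra, IsLUB d T ∧
      ∀ ξ, Tendsto (fun a : d => (a : H →L[ℂ] H) ξ) atTop (𝓝 ((T : H →L[ℂ] H) ξ)) := by
  choose F hF using exists_tendsto_apply hne hd hb
  obtain ⟨b, hb⟩ := hb
  obtain ⟨a₀, ha₀⟩ := hne
  have : Nonempty d := ⟨⟨a₀, ha₀⟩⟩
  have : IsDirectedOrder d := ⟨directedOn_iff_directed.1 hd⟩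
  set B : H →L[ℂ] H := b - a₀ with hB
  let T₀ : H →ₗ[ℂ] H := linearMapOfTendsto F (fun a : d => ((a : H →L[ℂ] H) : H →ₗ[ℂ] H))
    (tendsto_pi_nhds.2 hF)
  let T : H →L[ℂ] H := T₀.mkContinuous (‖B‖ + ‖(a₀ : H →L[ℂ] H)‖) fun ξ => by
    refine le_of_tendsto (hF ξ).norm ?_
    filter_upwards [Ici_mem_atTop (⟨a₀, ha₀⟩ : d)] with a ha
    refine ContinuousLinearMap.le_of_opNorm_le _ ?_ ξ
    calc _ = ‖((a : H →L[ℂ] H) - a₀) + a₀‖ := by rw [sub_add_cancel]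
      _ ≤ _ := (norm_add_le _ _).trans (by gcongr; exact norm_sub_le_of_le le_rfl ha (hb a.2))
  have hT : ∀ ξ, Tendsto (fun a : d => (a : H →L[ℂ] H) ξ) atTop (𝓝 (T ξ)) := hF
  have hq : ∀ ξ, Tendsto (fun a : d => ⟪ξ, (a : H →L[ℂ] H) ξ⟫_ℂ) atTop (𝓝 ⟪ξ, T ξ⟫_ℂ) :=
    fun ξ => tendsto_const_nhds.inner (hT ξ)
  refine ⟨⟨T, M.mem_of_tendsto hT⟩, ⟨fun a ha => ?_, fun c hc => ?_⟩, hT⟩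
  · refine le_iff_forall_inner_le.2 fun ξ => ge_of_tendsto (hq ξ) ?_
    filter_upwards [Ici_mem_atTop (⟨a, ha⟩ : d)] with x hx
    exact le_iff_forall_inner_le.1 hx ξ
  · exact le_iff_forall_inner_le.2 fun ξ => le_of_tendsto (hq ξ)
      (Eventually.of_forall fun x => le_iff_forall_inner_le.1 (hc x.2) ξ)

theorem tendsto_of_isLUB {d : Set M.toStarSubalgebra} (hne : d.Nonempty)
    (hd : DirectedOn (· ≤ ·) d) {T : M.toStarSubalgebra} (hT : IsLUB d T) (ξ : H) :
    Tendsto (fun a : d => (a : H →L[ℂ] H) ξ) atTop (𝓝 ((T : H →L[ℂ] H) ξ)) := by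
  obtain ⟨S, hS, h⟩ := exists_isLUB_tendsto hne hd hT.bddAbove
  rw [hT.unique hS]
  exact h ξ

theorem scottContinuous_inner (ξ : H) :
    ScottContinuous fun x : M.toStarSubalgebra => ⟪ξ, (x : H →L[ℂ] H) ξ⟫_ℂ := by
  intro d hne hd T hT
  have : Nonempty d := hne.to_subtype
  have : IsDirectedOrder d := ⟨directedOn_iff_directed.1 hd⟩
  have hmono : ∀ {x y : M.toStarSubalgebra}, x ≤ y → _ := fun h => le_iff_forall_inner_le.1 h ξ
  refine ⟨?_, fun c hc => ?_⟩
  · rintro _ ⟨a, ha, rfl⟩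
    exact hmono (hT.1 ha)
  · exact le_of_tendsto (tendsto_const_nhds.inner (tendsto_of_isLUB hne hd hT ξ))
      (Eventually.of_forall fun x => hc ⟨x, x.2, rfl⟩)

/-- A von Neumann algebra as a C⋆-algebra. -/
@[reducible]
noncomputable def toCStarAlgebra (M : VonNeumannAlgebra H) : CStarAlgebra M.toStarSubalgebra :=
  StarSubalgebra.cstarAlgebra M.toStarSubalgebra
    (h_closed := CentralExpectation.isClosed_coe M)

attribute [local instance] toCStarAlgebra

/-- The order is that of operators on `H`, so a square root has to be found inside `M`. It is taken
by functional calculus in `M`, where the spectrum is the same as in the operators on `H`. -/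
theorem toStarOrderedRing (M : VonNeumannAlgebra H) : StarOrderedRing M.toStarSubalgebra := by
  refine StarOrderedRing.of_nonneg_iff' (fun {x y} h z => ?_) fun x => ⟨fun hx => ?_, ?_⟩
  · change (z : H →L[ℂ] H) + x ≤ z + y
    gcongr
  · have : IsClosed (M.toStarSubalgebra : Set (H →L[ℂ] H)) := CentralExpectation.isClosed_coe M
    have hx' : (0 : H →L[ℂ] H) ≤ x := hx
    have hsa : IsSelfAdjoint x := Subtype.ext hx'.isSelfAdjoint
    have hsp : ∀ t ∈ spectrum ℝ x, 0 ≤ t := fun t ht => by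
      have h1 : ((t : ℂ)) ∈ spectrum ℂ x := by
        simpa using spectrum.algebraMap_mem ℂ ht
      rw [StarSubalgebra.spectrum_eq] at h1
      have h2 : (0 : ℂ) ≤ t := spectrum_nonneg_of_nonneg hx' h1
      exact_mod_cast h2
    refine ⟨cfc Real.sqrt x, ?_⟩
    rw [(cfc_predicate Real.sqrt x : IsSelfAdjoint _).star_eq,
      ← cfc_mul _ _ x (by fun_prop) (by fun_prop)]
    conv_lhs => rw [← cfc_id' ℝ x]
    exact cfc_congr fun t ht => (Real.mul_self_sqrt (hsp t ht)).symm
  · rintro ⟨s, rfl⟩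
    exact CentralExpectation.star_mul_self_nonneg' s

end VonNeumannAlgebra

end Order

/-! ### Central cutoffs and resolvent estimates -/

namespace CStarAlgebra

variable {A : Type*} [CStarAlgebra A] [PartialOrder A] [StarOrderedRing A]

/-- A cutoff adapted to a positive element: `k²` is equal to one at the given character, and
`k⁴ h` is small. -/
theorem exists_cutoff (U : A →ₐ[ℂ] ℂ) {h : A} (hh : 0 ≤ h) {ε : ℝ} (hε : 0 < ε)
    (hU : (U h).re ≤ ε) :
    ∃ k l : A, star k = k ∧ star l = l ∧ k * k + l * l = 1 ∧ U l = 0 ∧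
      k * k * h * (k * k) ≤ algebraMap ℝ A ε := by
  have hsp : ∀ t ∈ spectrum ℝ h, 0 ≤ t := fun t ht => spectrum_nonneg_of_nonneg hh ht
  have hsa : IsSelfAdjoint h := hh.isSelfAdjoint
  -- `G` is `1` on `t ≤ ε` and satisfies `G t * t ≤ ε`; then `k = √G` and `l = √(1 - G)` at `h`. The
  -- character commutes with functional calculus, and `G (U h) = 1` gives `U l = 0`.
  let G : ℝ → ℝ := fun t => ε / max t ε
  have hm : ∀ t, 0 < max t ε := fun t => lt_max_of_lt_right hε
  have hG : Continuous G := continuous_const.div (by fun_prop) fun t => (hm t).ne'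
  have hG0 : ∀ t, 0 ≤ G t := fun t => (div_pos hε (hm t)).le
  have hG1 : ∀ t, G t ≤ 1 := fun t => (div_le_one (hm t)).2 (le_max_right _ _)
  have hGt : ∀ t, G t * t ≤ ε := fun t => by
    rw [div_mul_eq_mul_div, div_le_iff₀ (hm t)]
    gcongr
    exact le_max_left _ _
  refine ⟨cfc (fun t => √(G t)) h, cfc (fun t => √(1 - G t)) h,
    (cfc_predicate _ h : IsSelfAdjoint _), (cfc_predicate _ h : IsSelfAdjoint _), ?_, ?_, ?_⟩
  · rw [← cfc_mul _ _ h (by fun_prop) (by fun_prop), ← cfc_mul _ _ h (by fun_prop) (by fun_prop),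
      ← cfc_add h _ _ (by fun_prop) (by fun_prop), ← cfc_one ℝ h]
    refine cfc_congr fun t _ => ?_
    have := hG0 t
    have := hG1 t
    simp only [Real.mul_self_sqrt (hG0 t), Real.mul_self_sqrt (sub_nonneg.2 (hG1 t))]
    simp
  · let φ : A →⋆ₐ[ℂ] ℂ := StarAlgHomClass.toStarAlgHom U
    have hφ : Continuous φ := by fun_prop
    have h1 : U (cfc (fun t => √(1 - G t)) h) = cfc (fun t => √(1 - G t)) (U h) :=
      StarAlgHomClass.map_cfc (S := ℂ) φ _ h (by fun_prop) hφ hsa (hsa.map φ)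
    have h2 : U h = algebraMap ℝ ℂ (U h).re := by
      have h3 : IsSelfAdjoint (U h) := hsa.map φ
      exact (Complex.conj_eq_iff_re.1 h3).symm
    rw [h1, h2, cfc_algebraMap]
    have h3 : G (U h).re = 1 := by
      simp only [G, max_eq_right hU]
      exact div_self hε.ne'
    simp [h3]
  · have h1 : cfc (fun t => √(G t)) h * cfc (fun t => √(G t)) h = cfc G h := by
      rw [← cfc_mul _ _ h (by fun_prop) (by fun_prop)]
      exact cfc_congr fun t _ => Real.mul_self_sqrt (hG0 t)
    have h2 : cfc G h * h * cfc G h = cfc (fun t => G t * t * G t) h := by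
      rw [cfc_mul (fun t => G t * t) _ h (by fun_prop) (by fun_prop),
        cfc_mul _ (fun t => t) h (by fun_prop) (by fun_prop), cfc_id' ℝ h]
    rw [h1, h2]
    refine cfc_le_algebraMap _ _ h (fun t ht => ?_) (by fun_prop)
    have := hG0 t
    have := hG1 t
    have := hGt t
    have := hsp t ht
    calc G t * t * G t ≤ ε * 1 := by gcongr
      _ = ε := mul_one ε

theorem star_mul_self_le_one {x : A} (hx : ‖x‖ ≤ 1) : star x * x ≤ 1 := by
  refine CStarAlgebra.norm_le_one_iff_of_nonneg (star x * x) |>.1 ?_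
  rw [CStarRing.norm_star_mul_self]
  nlinarith [norm_nonneg x]

theorem norm_le_one_of_star_mul_self_le {x : A} (hx : star x * x ≤ 1) : ‖x‖ ≤ 1 := by
  have h := (CStarAlgebra.norm_le_one_iff_of_nonneg (star x * x)).2 hx
  rw [CStarRing.norm_star_mul_self] at h
  nlinarith [norm_nonneg x]

/-- The scalars range over any commutative ring, so that `p` can be an element of the center of the
algebra. -/
theorem one_sub_convex_mul_convex {R B : Type*} [CommRing R] [Ring B] [Algebra R B] (p : R)
    (x x' y y' : B) : 1 - (p • x' + (1 - p) • y') * (p • x + (1 - p) • y) =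
      p • (1 - x' * x) + (1 - p) • (1 - y' * y) + (p * (1 - p)) • ((x' - y') * (x - y)) := by
  simp only [mul_add, add_mul, mul_sub, sub_mul, smul_mul_assoc, mul_smul_comm]
  module

/-- A convex combination with central coefficients of two contractions is a contraction. -/
theorem norm_central_convex_le_one {x y k l : A} (hx : ‖x‖ ≤ 1) (hy : ‖y‖ ≤ 1)
    (hk : star k = k) (hl : star l = l) (hkl : k * k + l * l = 1)
    (hkc : ∀ z, k * z = z * k) (hlc : ∀ z, l * z = z * l) :
    ‖k * k * x + l * l * y‖ ≤ 1 := by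
  refine norm_le_one_of_star_mul_self_le ?_
  have h1 : 0 ≤ star k * (1 - star x * x) * k :=
    star_left_conjugate_nonneg (sub_nonneg.2 (star_mul_self_le_one hx)) k
  have h2 : 0 ≤ star l * (1 - star y * y) * l :=
    star_left_conjugate_nonneg (sub_nonneg.2 (star_mul_self_le_one hy)) l
  have h3 : 0 ≤ star (k * l) * (star (x - y) * (x - y)) * (k * l) :=
    star_left_conjugate_nonneg (star_mul_self_nonneg _) _
  have hkc' : ∀ z, k * z * k = k * k * z := fun z => by rw [mul_assoc, ← hkc, ← mul_assoc]
  have hlc' : ∀ z, l * z * l = l * l * z := fun z => by rw [mul_assoc, ← hlc, ← mul_assoc]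
  have hll : l * l = 1 - k * k := eq_sub_of_add_eq' hkl
  have hkk : ∀ z, k * k * z = z * (k * k) := fun z => by
    rw [mul_assoc, hkc z, ← mul_assoc, hkc, ← mul_assoc]
  let p : Subring.center A := ⟨k * k, Subring.mem_center_iff.2 fun z => (hkk z).symm⟩
  have h4 := one_sub_convex_mul_convex p x (star x) y (star y)
  have hp : ∀ z : A, p • z = k * k * z := fun z => rfl
  have hq : ∀ z : A, (1 - p) • z = l * l * z := fun z => by rw [hll]; rfl
  have hpq : ∀ z : A, (p * (1 - p)) • z = l * k * z * (k * l) := fun z => by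
    rw [mul_smul, hp, hq, hkk (l * l * z), mul_assoc (l * l), ← hkk, ← hlc', ← hkc']
    simp only [mul_assoc]
  have h5 : star (k * k * x + l * l * y) = k * k * star x + l * l * star y := by
    simp only [star_add, star_mul, hk, hl]
    rw [← hkk, hll, mul_sub, sub_mul, ← hkk, mul_one, one_mul]
  rw [hp, hp, hq, hq, hpq, hp, hq, ← h5] at h4
  rw [← sub_nonneg, h4, ← hkc', ← hlc', ← star_sub]
  rw [hk] at h1
  rw [hl] at h2
  rw [star_mul, hk, hl] at h3
  exact add_nonneg (add_nonneg h1 h2) h3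

theorem isUnit_one_add {s : A} (hs : 0 ≤ s) : IsUnit (1 + s) :=
  CStarAlgebra.isUnit_of_le 1 (le_add_of_nonneg_right hs)

theorem inverse_one_add_nonneg {s : A} (hs : 0 ≤ s) : 0 ≤ Ring.inverse (1 + s) := by
  have hu := isUnit_one_add hs
  have h1 : 0 ≤ 1 + s := add_nonneg zero_le_one hs
  have h2 : star (Ring.inverse (1 + s)) = Ring.inverse (1 + s) := by
    rw [← Ring.inverse_star, h1.isSelfAdjoint.star_eq]
  have h := star_left_conjugate_nonneg h1 (Ring.inverse (1 + s))
  rwa [h2, Ring.inverse_mul_cancel _ hu, one_mul] at h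

theorem inverse_one_add_anti {s t : A} (hs : 0 ≤ s) (hst : s ≤ t) :
    Ring.inverse (1 + t) ≤ Ring.inverse (1 + s) := by
  refine CStarAlgebra.antitoneOn_ringInverse ?_ ?_ (add_le_add_right hst 1)
  · exact (isUnit_one_add hs).isStrictlyPositive (add_nonneg zero_le_one hs)
  · exact (isUnit_one_add (hs.trans hst)).isStrictlyPositive
      (add_nonneg zero_le_one (hs.trans hst))

theorem inverse_one_add_le_one {s : A} (hs : 0 ≤ s) : Ring.inverse (1 + s) ≤ 1 := by
  simpa using inverse_one_add_anti le_rfl hs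

/-- With `v = (1 + s)⁻¹`, the difference `s - (1 - v)` equals `s v s`. -/
theorem one_sub_inverse_one_add_le {s : A} (hs : 0 ≤ s) : 1 - Ring.inverse (1 + s) ≤ s := by
  have hu := isUnit_one_add hs
  have h1 := Ring.inverse_mul_cancel _ hu
  have h2 := Ring.mul_inverse_cancel _ hu
  have h := star_left_conjugate_nonneg (inverse_one_add_nonneg hs) s
  set v := Ring.inverse (1 + s)
  rw [hs.isSelfAdjoint.star_eq] at h
  rw [mul_add, mul_one] at h1
  rw [add_mul, one_mul] at h2
  rw [eq_sub_of_add_eq' h2, sub_mul, one_mul, eq_sub_of_add_eq' h1] at h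
  rwa [← sub_nonneg]

theorem mul_self_le_self {r : A} (h0 : 0 ≤ r) (h1 : r ≤ 1) : r * r ≤ r := by
  have h := star_left_conjugate_le_conjugate h1 (CFC.sqrt r)
  have h2 : star (CFC.sqrt r) = CFC.sqrt r := (CFC.sqrt_nonneg r).isSelfAdjoint
  have h3 : CFC.sqrt r * CFC.sqrt r = r := CFC.sqrt_mul_sqrt_self r
  have h4 : CFC.sqrt r * r * CFC.sqrt r = r * r := by
    conv_lhs => enter [1, 2]; rw [← h3]
    rw [mul_assoc, mul_assoc, h3, ← mul_assoc, h3]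
  rwa [h2, mul_one, h3, h4] at h

/-- For `v = (1 + s)⁻¹` and `z = d v d*`, one has `c z² ≤ d v (1 + s) v d* = z`, so `c ‖z‖ ≤ 1`.
Moreover `r² ≤ r ≤ v` gives `‖d r‖² = ‖d r² d*‖ ≤ ‖z‖`. -/
theorem norm_mul_sq_le_of_le_inverse {s d r : A} {c : ℝ} (hs : 0 ≤ s) (hc : 0 < c)
    (hd : c • (star d * d) ≤ s) (hr : 0 ≤ r) (hrs : r ≤ Ring.inverse (1 + s)) :
    c * ‖d * r‖ ^ 2 ≤ 1 := by
  have hu := isUnit_one_add hs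
  have hv := inverse_one_add_nonneg hs
  have hv1 := inverse_one_add_le_one hs
  have hv2 := Ring.inverse_mul_cancel _ hu
  set v := Ring.inverse (1 + s)
  set z := d * v * star d with hz
  have hz0 : 0 ≤ z := star_right_conjugate_nonneg hv d
  have hz2 : c • (z * z) ≤ z := by
    have h1 : c • (star d * d) ≤ 1 + s := hd.trans (le_add_of_nonneg_left zero_le_one)
    have h2 := star_right_conjugate_le_conjugate h1 (d * v)
    have h3 : d * v * (c • (star d * d)) * star (d * v) = c • (z * z) := by
      simp only [hz, star_mul, hv.isSelfAdjoint.star_eq, mul_smul_comm, smul_mul_assoc, mul_assoc]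
    have h4 : d * v * (1 + s) * star (d * v) = z := by
      rw [mul_assoc d, hv2, mul_one, star_mul, hv.isSelfAdjoint.star_eq, hz, mul_assoc]
    rwa [h3, h4] at h2
  have hzn : c * ‖z‖ ≤ 1 := by
    have h1 : ‖z * z‖ = ‖z‖ * ‖z‖ := by
      conv_lhs => enter [1, 1]; rw [← hz0.isSelfAdjoint.star_eq]
      exact CStarRing.norm_star_mul_self
    have h2 := CStarAlgebra.norm_le_norm_of_nonneg_of_le
      (smul_nonneg hc.le (by
        simpa [hz0.isSelfAdjoint.star_eq] using star_mul_self_nonneg z)) hz2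
    rw [norm_smul, h1, Real.norm_of_nonneg hc.le] at h2
    by_contra! h3
    nlinarith [norm_nonneg z]
  have h1 : ‖d * r‖ ^ 2 ≤ ‖z‖ := by
    rw [sq, ← CStarRing.norm_self_mul_star, star_mul, hr.isSelfAdjoint.star_eq]
    refine CStarAlgebra.norm_le_norm_of_nonneg_of_le ?_ ?_
    · have h := mul_star_self_nonneg (d * r)
      rwa [star_mul, hr.isSelfAdjoint.star_eq] at h
    · have h2 : r * r ≤ v := (mul_self_le_self hr (hrs.trans hv1)).trans hrs
      have h3 := star_right_conjugate_le_conjugate h2 d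
      simpa only [hz, mul_assoc] using h3
  nlinarith

end CStarAlgebra

/-! ### Uniform closeness and a noncommutative Egorov theorem -/

namespace VonNeumannAlgebra

open Filter Topology

variable {H : Type u} [NormedAddCommGroup H] [InnerProductSpace ℂ H] [CompleteSpace H]
  {M N : VonNeumannAlgebra H}

/-- The unit ball of a von Neumann algebra is strongly sequentially complete. -/
theorem exists_tendsto_of_cauchySeq {y : ℕ → M.toStarSubalgebra} (hy : ∀ n, ‖y n‖ ≤ 1)
    (hc : ∀ ξ, CauchySeq fun n => (y n : H →L[ℂ] H) ξ) :
    ∃ Y : M.toStarSubalgebra, ‖Y‖ ≤ 1 ∧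
      ∀ ξ, Tendsto (fun n => (y n : H →L[ℂ] H) ξ) atTop (𝓝 ((Y : H →L[ℂ] H) ξ)) := by
  choose F hF using fun ξ => cauchySeq_tendsto_of_complete (hc ξ)
  let T₀ : H →ₗ[ℂ] H := linearMapOfTendsto F (fun n => ((y n : H →L[ℂ] H) : H →ₗ[ℂ] H))
    (tendsto_pi_nhds.2 hF)
  have hb : ∀ ξ, ‖T₀ ξ‖ ≤ 1 * ‖ξ‖ := fun ξ =>
    le_of_tendsto (hF ξ).norm
      (Eventually.of_forall fun n => ContinuousLinearMap.le_of_opNorm_le _ (hy n) ξ)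
  let T : H →L[ℂ] H := T₀.mkContinuous 1 hb
  have hT : ∀ ξ, Tendsto (fun n => (y n : H →L[ℂ] H) ξ) atTop (𝓝 (T ξ)) := hF
  exact ⟨⟨T, M.mem_of_tendsto hT⟩, T₀.mkContinuous_norm_le zero_le_one hb, hT⟩

theorem sum_Ico_half_pow_le {a b : ℕ} (h : a ≤ b) :
    ∑ j ∈ Finset.Ico a b, (1 / 2 : ℝ) ^ j ≤ 2 * (1 / 2) ^ a := by
  have h1 : ∑ j ∈ Finset.Ico a b, (1 / 2 : ℝ) ^ j = 2 * (1 / 2) ^ a - 2 * (1 / 2) ^ b := by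
    induction b, h using Nat.le_induction with
    | base => simp
    | succ b hab ih =>
      rw [Finset.sum_Ico_succ_top hab, ih, pow_succ]
      ring
  have : (0 : ℝ) < (1 / 2) ^ b := by positivity
  linarith

namespace CentralExpectation

attribute [local instance] toCStarAlgebra toStarOrderedRing

variable (E : CentralExpectation M N) (U : N.toStarSubalgebra →ₐ[ℂ] ℂ)

theorem map_mono {x y : M.toStarSubalgebra} (h : x ≤ y) : E.toLinearMap x ≤ E.toLinearMap y := by
  have h1 := E.map_nonneg (y - x) (sub_nonneg.2 h)
  rwa [map_sub, sub_nonneg] at h1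

theorem functional_mono {x y : M.toStarSubalgebra} (h : x ≤ y) :
    E.functional U x ≤ E.functional U y := by
  have h1 := E.functional_nonneg U (y - x) (sub_nonneg.2 h)
  rwa [map_sub, sub_nonneg] at h1

theorem character_algebraMap_real (ε : ℝ) : U (algebraMap ℝ N.toStarSubalgebra ε) = ε := by
  rw [IsScalarTower.algebraMap_apply ℝ ℂ N.toStarSubalgebra, AlgHom.commutes]
  rfl

theorem functional_re_le_of_le {x : M.toStarSubalgebra} {ε : ℝ}
    (h : E.toLinearMap x ≤ algebraMap ℝ N.toStarSubalgebra ε) : (E.functional U x).re ≤ ε := by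
  have h1 := character_nonneg U _ (sub_nonneg.2 h)
  rw [map_sub, character_algebraMap_real, sub_nonneg] at h1
  exact (Complex.le_def.1 h1).1

/-- Given contractions `x`, `y` that are close at the character `U`, one can modify `x` within its
class so that it is uniformly close to `y`. -/
theorem exists_uniformly_close {x y : M.toStarSubalgebra} (hx : ‖x‖ ≤ 1) (hy : ‖y‖ ≤ 1) {ε : ℝ}
    (hε : 0 < ε) (h : (E.functional U (star (x - y) * (x - y))).re ≤ ε) :
    ∃ y' : M.toStarSubalgebra, ‖y'‖ ≤ 1 ∧ y' - x ∈ E.ideal U ∧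
      E.toLinearMap (star (y' - y) * (y' - y)) ≤ algebraMap ℝ N.toStarSubalgebra ε := by
  obtain ⟨k, l, hk, hl, hkl, hUl, hle⟩ := CStarAlgebra.exists_cutoff U
    (E.map_nonneg _ (star_mul_self_nonneg' (x - y))) hε h
  let ι := StarSubalgebra.inclusion E.le
  have hcomm : ∀ (n : N.toStarSubalgebra) (z : M.toStarSubalgebra), ι n * z = z * ι n :=
    fun n z => Subtype.ext (E.central n z)
  have hkl' : ι k * ι k + ι l * ι l = 1 := by rw [← map_mul, ← map_mul, ← map_add, hkl, map_one]
  have hιk : star (ι k) = ι k := by rw [← map_star, hk]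
  have hιl : star (ι l) = ι l := by rw [← map_star, hl]
  have hl_mem : ι l ∈ E.ideal U := by
    rw [mem_ideal, hιl, ← map_mul, functional, LinearMap.comp_apply, E.map_inclusion]
    simp [hUl]
  -- For `y' = k² x + l² y`, the difference `y' - x = l² (y - x)` is in the ideal because `U l = 0`,
  -- and `E |y' - y|² = k² (E |x - y|²) k² ≤ ε` by the cutoff.
  refine ⟨ι k * ι k * x + ι l * ι l * y, CStarAlgebra.norm_central_convex_le_one hx hy hιk hιl hkl'
    (hcomm k) (hcomm l), ?_, ?_⟩
  · have h1 : ι k * ι k * x + ι l * ι l * y - x = (y - x) * ι l * ι l := by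
      have h2 : (y - x) * ι l * ι l = ι l * ι l * (y - x) := by
        rw [mul_assoc, ← map_mul, hcomm (l * l)]
      rw [h2, eq_sub_of_add_eq hkl']
      noncomm_ring
    rw [h1]
    exact (E.ideal U).mul_mem_left _ hl_mem
  · have h1 : ι k * ι k * x + ι l * ι l * y - y = ι (k * k) * (x - y) := by
      rw [map_mul, eq_sub_of_add_eq' hkl']
      noncomm_ring
    have h2 : star (ι (k * k) * (x - y)) * (ι (k * k) * (x - y))
        = ι (k * k) * (star (x - y) * (x - y)) * ι (k * k) := by
      rw [star_mul, ← map_star, star_mul, hk, hcomm (k * k) (x - y), ← mul_assoc,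
        ← hcomm _ (star (x - y)), mul_assoc (ι (k * k))]
    rw [h1, h2, E.map_right_mul, E.map_left_mul]
    exact hle

theorem algebraMap_real_mono {a b : ℝ} (h : a ≤ b) :
    algebraMap ℝ N.toStarSubalgebra a ≤ algebraMap ℝ N.toStarSubalgebra b := by
  rw [← sub_nonneg, ← map_sub, Algebra.algebraMap_eq_smul_one]
  exact smul_nonneg (sub_nonneg.2 h) zero_le_one

/-- A noncommutative form of Egorov's theorem: if `E |y (n + 1) - y n|²` decreases fast, then
`(y n)` converges uniformly after multiplication by `1 - w k`, where `w k` is small. -/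
theorem exists_egorov {y : ℕ → M.toStarSubalgebra}
    (hy : ∀ n, E.toLinearMap (star (y (n + 1) - y n) * (y (n + 1) - y n))
      ≤ algebraMap ℝ N.toStarSubalgebra ((1 / 8) ^ n)) :
    ∃ w : ℕ → M.toStarSubalgebra, (∀ k, 0 ≤ w k) ∧ (∀ k, w k ≤ 1) ∧ Antitone w ∧
      (∀ k, E.toLinearMap (w k) ≤ algebraMap ℝ N.toStarSubalgebra (2 * (1 / 2) ^ k)) ∧
      ∀ k n, k ≤ n → ‖(y (n + 1) - y n) * (1 - w k)‖ ≤ (1 / 2) ^ n := by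
  let D : ℕ → M.toStarSubalgebra := fun n => y (n + 1) - y n
  -- The weight `4 ^ n` balances two needs: `E (p n) ≤ 4 ^ n / 8 ^ n` is summable, and `4 ^ n |D n|²
  -- ≤ s` yields the factor `(1 / 2) ^ n` in the uniform estimate.
  let p : ℕ → M.toStarSubalgebra := fun n => (4 ^ n : ℝ) • (star (D n) * D n)
  have hp : ∀ n, 0 ≤ p n := fun n => smul_nonneg (by positivity) (star_mul_self_nonneg _)
  let s : ℕ → ℕ → M.toStarSubalgebra := fun k m => ∑ n ∈ Finset.Ico k m, p n
  have hs : ∀ k m, 0 ≤ s k m := fun k m => Finset.sum_nonneg fun n _ => hp n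
  have hsm : ∀ k, Monotone (s k) := fun k m m' h =>
    Finset.sum_le_sum_of_subset_of_nonneg (Finset.Ico_subset_Ico_right h) fun n _ _ => hp n
  have hsa : ∀ m, Antitone fun k => s k m := fun m k k' h =>
    Finset.sum_le_sum_of_subset_of_nonneg (Finset.Ico_subset_Ico_left h) fun n _ _ => hp n
  -- The sums `s k m` may be unbounded in `m`, but `v = s / (1 + s)` increases with `s`, stays below
  -- `1` and satisfies `v ≤ s`. Its supremum over `m` is `w k`, and normality of `E` carries the
  -- bound over to it.
  let v : ℕ → ℕ → M.toStarSubalgebra := fun k m => 1 - Ring.inverse (1 + s k m)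
  have hv0 : ∀ k m, 0 ≤ v k m := fun k m =>
    sub_nonneg.2 (CStarAlgebra.inverse_one_add_le_one (hs k m))
  have hv1 : ∀ k m, v k m ≤ 1 := fun k m =>
    sub_le_self _ (CStarAlgebra.inverse_one_add_nonneg (hs k m))
  have hvm : ∀ k, Monotone (v k) := fun k m m' h =>
    sub_le_sub_left (CStarAlgebra.inverse_one_add_anti (hs k m) (hsm k h)) 1
  have hva : ∀ m, Antitone fun k => v k m := fun m k k' h =>
    sub_le_sub_left (CStarAlgebra.inverse_one_add_anti (hs k' m) (hsa m h)) 1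
  have hdir : ∀ k, DirectedOn (· ≤ ·) (Set.range (v k)) := fun k =>
    directedOn_range.2 (hvm k).directed_le
  have hlub : ∀ k, ∃ w, IsLUB (Set.range (v k)) w := fun k => by
    obtain ⟨w, hw, -⟩ := exists_isLUB_tendsto (Set.range_nonempty (v k)) (hdir k)
      ⟨1, by rintro _ ⟨m, rfl⟩; exact hv1 k m⟩
    exact ⟨w, hw⟩
  choose w hw using hlub
  have hvw : ∀ k m, v k m ≤ w k := fun k m => (hw k).1 ⟨m, rfl⟩
  have hw0 : ∀ k, 0 ≤ w k := fun k => (hv0 k 0).trans (hvw k 0)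
  have hw1 : ∀ k, w k ≤ 1 := fun k => (hw k).2 (by rintro _ ⟨m, rfl⟩; exact hv1 k m)
  refine ⟨w, hw0, hw1, fun k k' h => (hw k').2 ?_, fun k => ?_, fun k n hkn => ?_⟩
  · rintro _ ⟨m, rfl⟩
    exact (hva m h).trans (hvw k m)
  · refine (E.normal (Set.range_nonempty (v k)) (hdir k) (hw k)).2 ?_
    rintro _ ⟨_, ⟨m, rfl⟩, rfl⟩
    refine (E.map_mono (CStarAlgebra.one_sub_inverse_one_add_le (hs k m))).trans ?_
    have hp' : ∀ n, E.toLinearMap (p n) ≤ algebraMap ℝ N.toStarSubalgebra ((1 / 2) ^ n) := by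
      intro n
      have h1 : E.toLinearMap (p n) = (4 ^ n : ℝ) • E.toLinearMap (star (D n) * D n) :=
        LinearMap.map_smul_of_tower _ _ _
      have h2 : algebraMap ℝ N.toStarSubalgebra ((1 / 2) ^ n)
          = (4 ^ n : ℝ) • algebraMap ℝ N.toStarSubalgebra ((1 / 8) ^ n) := by
        rw [Algebra.algebraMap_eq_smul_one, Algebra.algebraMap_eq_smul_one,
          smul_smul, ← mul_pow]
        norm_num
      rw [h1, h2]
      exact smul_le_smul_of_nonneg_left (hy n) (by positivity)
    rw [map_sum]
    rcases le_total k m with hkm | hkm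
    · refine (Finset.sum_le_sum fun n _ => hp' n).trans ?_
      rw [← map_sum]
      exact algebraMap_real_mono (sum_Ico_half_pow_le hkm)
    · rw [Finset.Ico_eq_empty_of_le hkm, Finset.sum_empty, ← map_zero (algebraMap ℝ _)]
      exact algebraMap_real_mono (by positivity)
  · have h1 : p n ≤ s k (n + 1) :=
      Finset.single_le_sum (fun j _ => hp j) (Finset.mem_Ico.2 ⟨hkn, n.lt_succ_self⟩)
    have h2 : 1 - w k ≤ Ring.inverse (1 + s k (n + 1)) := sub_le_comm.1 (hvw k (n + 1))
    have h3 := CStarAlgebra.norm_mul_sq_le_of_le_inverse (hs k (n + 1)) (by positivity) h1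
      (sub_nonneg.2 (hw1 k)) h2
    refine (pow_le_pow_iff_left₀ (norm_nonneg _) (by positivity) two_ne_zero).1 ?_
    have h4 : (((1 / 2 : ℝ)) ^ n) ^ 2 * 4 ^ n = 1 := by
      rw [← pow_mul, mul_comm n 2, pow_mul, ← mul_pow]
      norm_num
    have h5 : (0 : ℝ) < 4 ^ n := by positivity
    rw [← mul_le_mul_iff_left₀ h5, h4, mul_comm]
    exact h3

/-- The supremum `T` of the `1 - w k` satisfies `E (1 - T) ≤ 2 * (1 / 2) ^ k` for all `k`, so `T =
1` by faithfulness: `w k` tends strongly to zero. -/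
theorem exists_norm_apply_lt {w : ℕ → M.toStarSubalgebra} (hw0 : ∀ k, 0 ≤ w k)
    (hwa : Antitone w)
    (hE : ∀ k, E.toLinearMap (w k) ≤ algebraMap ℝ N.toStarSubalgebra (2 * (1 / 2) ^ k))
    (ξ : H) {ε : ℝ} (hε : 0 < ε) : ∃ k, ‖(w k : H →L[ℂ] H) ξ‖ < ε := by
  let r : ℕ → M.toStarSubalgebra := fun k => 1 - w k
  have hr : Monotone r := fun k k' h => sub_le_sub_left (hwa h) 1
  have hdir : DirectedOn (· ≤ ·) (Set.range r) := directedOn_range.2 hr.directed_le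
  have hr1 : ∀ k, r k ≤ 1 := fun k => sub_le_self _ (hw0 k)
  obtain ⟨T, hT, hlim⟩ := exists_isLUB_tendsto (Set.range_nonempty r) hdir
      ⟨1, by rintro _ ⟨m, rfl⟩; exact hr1 m⟩
  have hT1 : T ≤ 1 := hT.2 (by rintro _ ⟨m, rfl⟩; exact hr1 m)
  have hT0 : 0 ≤ 1 - T := sub_nonneg.2 hT1
  have hEle : ∀ k, E.toLinearMap (1 - T) ≤ algebraMap ℝ N.toStarSubalgebra (2 * (1 / 2) ^ k) :=
    fun k => (E.map_mono (sub_le_comm.1 (hT.1 ⟨k, rfl⟩))).trans (hE k)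
  have hE0 : E.toLinearMap (1 - T) = 0 := by
    rw [← norm_le_zero_iff]
    have h1 : Tendsto (fun k : ℕ => 2 * (1 / 2 : ℝ) ^ k) atTop (𝓝 (2 * 0)) :=
      (tendsto_pow_atTop_nhds_zero_of_lt_one (by norm_num) (by norm_num)).const_mul 2
    rw [mul_zero] at h1
    refine ge_of_tendsto' h1 fun k => ?_
    exact CStarAlgebra.norm_le_iff_le_algebraMap _ (by positivity) (E.map_nonneg _ hT0) |>.2
      (hEle k)
  have hTone : T = 1 := by
    obtain ⟨z, hz⟩ := CStarAlgebra.nonneg_iff_eq_star_mul_self.1 hT0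
    rw [hz] at hE0
    have h1 := E.faithful z hE0
    rw [h1, mul_zero, sub_eq_zero] at hz
    exact hz.symm
  have : Nonempty (Set.range r) := (Set.range_nonempty r).to_subtype
  have : IsDirectedOrder (Set.range r) := ⟨directedOn_iff_directed.1 hdir⟩
  obtain ⟨⟨_, k, rfl⟩, hk⟩ := ((Metric.tendsto_nhds.1 (hlim ξ)) ε hε).exists
  refine ⟨k, ?_⟩
  rw [hTone, dist_eq_norm'] at hk
  simpa [r] using hk

end CentralExpectation

end VonNeumannAlgebra

/-! ### 2-norm closedness of the unit ball -/

namespace VonNeumannAlgebra.CentralExpectation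

open Filter Topology

variable {H : Type u} [NormedAddCommGroup H] [InnerProductSpace ℂ H] [CompleteSpace H]
  {M N : VonNeumannAlgebra H}

attribute [local instance] toCStarAlgebra toStarOrderedRing

variable (E : CentralExpectation M N) (U : N.toStarSubalgebra →ₐ[ℂ] ℂ)

theorem norm_sub_mul_le {y : ℕ → M.toStarSubalgebra} {r : M.toStarSubalgebra} {k : ℕ}
    (h : ∀ n, k ≤ n → ‖(y (n + 1) - y n) * r‖ ≤ (1 / 2) ^ n) {a b : ℕ} (hka : k ≤ a)
    (hab : a ≤ b) : ‖(y b - y a) * r‖ ≤ 2 * (1 / 2) ^ a := by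
  rw [← Finset.sum_Ico_sub y hab, Finset.sum_mul]
  exact (norm_sum_le_of_le _ fun n hn => h n (hka.trans (Finset.mem_Ico.1 hn).1)).trans
    (sum_Ico_half_pow_le hab)

/-- This bounds the 2-norm at `U` without any continuity of `U`. Split `z = a + b` with `a = z (1 -
w)`, `b = z w`, so `|z|² ≤ 2|a|² + 2|b|²`. The first part contributes at most `2δ² ≤ 4δ`, the second
at most `8δ` because `|b|² ≤ 4 w² ≤ 4 w`. -/
theorem functional_star_mul_self_le_of_egorov {z w : M.toStarSubalgebra} {δ : ℝ} (hδ : 0 ≤ δ)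
    (hδ1 : δ ≤ 2) (hz : ‖z‖ ≤ 2) (hw0 : 0 ≤ w) (hw1 : w ≤ 1)
    (hw : E.toLinearMap w ≤ algebraMap ℝ N.toStarSubalgebra δ) (hzw : ‖z * (1 - w)‖ ≤ δ) :
    (E.functional U (star z * z)).re ≤ 12 * δ := by
  set a := z * (1 - w) with ha
  set b := z * w with hb
  have hab : z = a + b := by rw [ha, hb, ← mul_add, sub_add_cancel, mul_one]
  have h1 : star z * z ≤ (2 : ℝ) • (star a * a) + (2 : ℝ) • (star b * b) := by
    have h2 : (2 : ℝ) • (star a * a) + (2 : ℝ) • (star b * b) - star z * z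
        = star (a - b) * (a - b) := by
      rw [hab, star_add, star_sub, two_smul, two_smul]
      noncomm_ring
    rw [← sub_nonneg, h2]
    exact star_mul_self_nonneg _
  have h2 : star b * b ≤ (4 : ℝ) • w := by
    have h3 : star z * z ≤ algebraMap ℝ _ 4 := by
      refine (CStarAlgebra.norm_le_iff_le_algebraMap _ (by norm_num) (star_mul_self_nonneg z)).1 ?_
      rw [CStarRing.norm_star_mul_self]
      nlinarith [norm_nonneg z]
    have h4 := star_left_conjugate_le_conjugate h3 w
    rw [hw0.isSelfAdjoint.star_eq, Algebra.algebraMap_eq_smul_one, mul_smul_comm, mul_one,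
      smul_mul_assoc] at h4
    rw [hb, star_mul, hw0.isSelfAdjoint.star_eq, mul_assoc, ← mul_assoc (star z), ← mul_assoc]
    exact h4.trans (smul_le_smul_of_nonneg_left (CStarAlgebra.mul_self_le_self hw0 hw1)
      (by norm_num))
  have h3 : (E.functional U (star a * a)).re ≤ δ ^ 2 := by
    have h4 := (Complex.le_def.1 (E.functional_star_mul_self_le U a)).1
    rw [Complex.ofReal_re] at h4
    nlinarith [norm_nonneg a]
  have h4 : (E.functional U (star b * b)).re ≤ 4 * (E.functional U w).re := by
    have h5 := (Complex.le_def.1 (E.functional_mono U h2)).1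
    rw [LinearMap.map_smul_of_tower] at h5
    simpa using h5
  have h5 := E.functional_re_le_of_le U hw
  have h6 := (Complex.le_def.1 (E.functional_mono U h1)).1
  rw [map_add, LinearMap.map_smul_of_tower, LinearMap.map_smul_of_tower] at h6
  simp only [Complex.add_re, Complex.real_smul, Complex.re_ofReal_mul] at h6
  nlinarith

/-- The unit ball is complete for uniformly fast Cauchy sequences in the `2`-norm of `E`. -/
theorem exists_limit {y : ℕ → M.toStarSubalgebra} (hy1 : ∀ n, ‖y n‖ ≤ 1)
    (hy : ∀ n, E.toLinearMap (star (y (n + 1) - y n) * (y (n + 1) - y n))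
      ≤ algebraMap ℝ N.toStarSubalgebra ((1 / 8) ^ n)) :
    ∃ Y : M.toStarSubalgebra, ‖Y‖ ≤ 1 ∧
      ∀ k, (E.functional U (star (Y - y k) * (Y - y k))).re ≤ 24 * (1 / 2) ^ k := by
  obtain ⟨w, hw0, hw1, hwa, hEw, hyw⟩ := E.exists_egorov hy
  have hdiff : ∀ k {a b : ℕ}, k ≤ a → a ≤ b → ∀ ξ,
      ‖(y b : H →L[ℂ] H) ((1 - w k : H →L[ℂ] H) ξ) - (y a : H →L[ℂ] H) ((1 - w k : H →L[ℂ] H) ξ)‖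
        ≤ 2 * (1 / 2) ^ a * ‖ξ‖ := fun k a b hka hab ξ =>
    ContinuousLinearMap.le_of_opNorm_le (((y b - y a) * (1 - w k) : M.toStarSubalgebra) : H →L[ℂ] H)
      (norm_sub_mul_le (hyw k) hka hab) ξ
  -- Split `ξ = (1 - w k) ξ + w k ξ`: on the first vector convergence is uniform, on the second all
  -- `y n` are small since `‖y n‖ ≤ 1`.
  have hcauchy : ∀ ξ, CauchySeq fun n => (y n : H →L[ℂ] H) ξ := fun ξ => by
    refine Metric.cauchySeq_iff'.2 fun ε hε => ?_
    obtain ⟨k, hk⟩ := E.exists_norm_apply_lt hw0 hwa hEw ξ (show 0 < ε / 4 by positivity)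
    have hlim : Tendsto (fun a : ℕ => 2 * (1 / 2 : ℝ) ^ a * ‖ξ‖) atTop (𝓝 (2 * 0 * ‖ξ‖)) :=
      ((tendsto_pow_atTop_nhds_zero_of_lt_one (by norm_num) (by norm_num)).const_mul 2).mul_const _
    rw [mul_zero, zero_mul] at hlim
    obtain ⟨a, hka, ha⟩ := ((eventually_ge_atTop k).and
      (hlim.eventually_lt_const (show 0 < ε / 2 by positivity))).exists
    refine ⟨a, fun b hab => ?_⟩
    have h1 := hdiff k hka hab ξ
    have hle : ∀ n, ‖(y n : H →L[ℂ] H) ((w k : H →L[ℂ] H) ξ)‖ ≤ ε / 4 := fun n => by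
      have h2 := ContinuousLinearMap.le_of_opNorm_le (y n : H →L[ℂ] H) (hy1 n)
        ((w k : H →L[ℂ] H) ξ)
      rw [one_mul] at h2
      exact h2.trans hk.le
    have h3 : ∀ n, (y n : H →L[ℂ] H) ξ = (y n : H →L[ℂ] H) ((1 - w k : H →L[ℂ] H) ξ)
        + (y n : H →L[ℂ] H) ((w k : H →L[ℂ] H) ξ) := fun n => by
      rw [← map_add]
      simp
    rw [dist_eq_norm, h3 b, h3 a, add_sub_add_comm]
    have h4 := norm_add_le
      ((y b : H →L[ℂ] H) ((1 - w k : H →L[ℂ] H) ξ) - (y a : H →L[ℂ] H) ((1 - w k : H →L[ℂ] H) ξ))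
      ((y b : H →L[ℂ] H) ((w k : H →L[ℂ] H) ξ) - (y a : H →L[ℂ] H) ((w k : H →L[ℂ] H) ξ))
    have h5 := norm_sub_le ((y b : H →L[ℂ] H) ((w k : H →L[ℂ] H) ξ))
      ((y a : H →L[ℂ] H) ((w k : H →L[ℂ] H) ξ))
    linarith [hle a, hle b]
  obtain ⟨Y, hY1, hY⟩ := exists_tendsto_of_cauchySeq hy1 hcauchy
  refine ⟨Y, hY1, fun k => ?_⟩
  have hYw : ‖(Y - y k) * (1 - w k)‖ ≤ 2 * (1 / 2) ^ k := by
    refine ContinuousLinearMap.opNorm_le_bound _ (by positivity) fun ξ => ?_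
    refine le_of_tendsto (((hY ((1 - w k : H →L[ℂ] H) ξ)).sub_const
      ((y k : H →L[ℂ] H) ((1 - w k : H →L[ℂ] H) ξ))).norm) ?_
    filter_upwards [eventually_ge_atTop k] with n hn using hdiff k le_rfl hn ξ
  have h1 := E.functional_star_mul_self_le_of_egorov U (by positivity)
    (mul_le_of_le_one_right zero_le_two (pow_le_one₀ (by norm_num) (by norm_num)))
    ((norm_sub_le _ _).trans (by linarith [hy1 k])) (hw0 k) (hw1 k) (hEw k) hYw
  linarith

/-- The functional `U ∘ E` as a positive linear map. -/
noncomputable def positiveFunctional : M.toStarSubalgebra →ₚ[ℂ] ℂ :=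
  PositiveLinearMap.mk₀ (E.functional U) (E.functional_nonneg U)

theorem positiveFunctional_apply (x : M.toStarSubalgebra) :
    E.positiveFunctional U x = E.functional U x := rfl

theorem positiveFunctional_one : E.positiveFunctional U 1 = 1 := E.functional_one U

theorem positiveFunctional_mul_comm (x y : M.toStarSubalgebra) :
    E.positiveFunctional U (x * y) = E.positiveFunctional U (y * x) :=
  E.functional_mul_comm U x y

theorem gnsVec_eq_zero_iff {x : M.toStarSubalgebra} :
    (E.positiveFunctional U).gnsVec x = 0 ↔ x ∈ E.ideal U := by
  rw [mem_ideal, ← positiveFunctional_apply, ← PositiveLinearMap.inner_gnsVec, inner_self_eq_zero]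

theorem gnsVec_eq_iff {x y : M.toStarSubalgebra} :
    (E.positiveFunctional U).gnsVec x = (E.positiveFunctional U).gnsVec y ↔ x - y ∈ E.ideal U := by
  rw [← gnsVec_eq_zero_iff, map_sub, sub_eq_zero]

/-- The image of the unit ball in the GNS space is closed. -/
theorem isClosed_gnsVec_closedBall :
    IsClosed ((E.positiveFunctional U).gnsVec '' Metric.closedBall 0 1) := by
  set v := (E.positiveFunctional U).gnsVec with hv
  refine isClosed_of_closure_subset fun ξ hξ => ?_
  -- With these radii consecutive `x n` are within `(1 / 4) ^ n`, and the square `(1 / 16) ^ n` is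
  -- below the required `(1 / 8) ^ n`.
  have hpos : ∀ n : ℕ, 0 < (1 / 4 : ℝ) ^ n / 2 := fun n => by positivity
  have hx : ∀ n : ℕ, ∃ x : M.toStarSubalgebra, ‖x‖ ≤ 1 ∧ ‖ξ - v x‖ < (1 / 4) ^ n / 2 := by
    intro n
    obtain ⟨_, ⟨x, hx, rfl⟩, hd⟩ := Metric.mem_closure_iff.1 hξ _ (hpos n)
    exact ⟨x, by simpa using hx, by rwa [dist_eq_norm] at hd⟩
  choose x hx1 hxξ using hx
  -- The new term keeps the class of `x (n + 1)` but is uniformly close to the representative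
  -- already chosen for `x n`.
  have hstep : ∀ n (y : M.toStarSubalgebra), ‖y‖ ≤ 1 → v y = v (x n) →
      ∃ y' : M.toStarSubalgebra, ‖y'‖ ≤ 1 ∧ v y' = v (x (n + 1)) ∧
        E.toLinearMap (star (y' - y) * (y' - y)) ≤ algebraMap ℝ N.toStarSubalgebra ((1 / 8) ^ n) := by
    intro n y hy hyx
    have h1 : (E.functional U (star (x (n + 1) - y) * (x (n + 1) - y))).re ≤ (1 / 8) ^ n := by
      rw [← positiveFunctional_apply, ← PositiveLinearMap.norm_gnsVec_sq, ← hv, map_sub, hyx]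
      have h2 : ‖v (x (n + 1)) - v (x n)‖ ≤ (1 / 4) ^ n := by
        have h3 := norm_sub_le (ξ - v (x n)) (ξ - v (x (n + 1)))
        rw [sub_sub_sub_cancel_left] at h3
        have h4 := hxξ n
        have h5 := hxξ (n + 1)
        have h6 : (1 / 4 : ℝ) ^ (n + 1) ≤ (1 / 4) ^ n :=
          pow_le_pow_of_le_one (by norm_num) (by norm_num) n.le_succ
        linarith
      calc _ ≤ ((1 / 4 : ℝ) ^ n) ^ 2 := by gcongr
        _ = (1 / 16) ^ n := by rw [← pow_mul, mul_comm n 2, pow_mul]; norm_num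
        _ ≤ _ := by gcongr; norm_num
    obtain ⟨y', hy'1, hy', hE⟩ := E.exists_uniformly_close U (hx1 (n + 1)) hy (by positivity) h1
    exact ⟨y', hy'1, (E.gnsVec_eq_iff U).2 hy', hE⟩
  choose! g hg1 hgx hgE using hstep
  let y : ℕ → M.toStarSubalgebra := fun n => Nat.rec (x 0) g n
  have hy : ∀ n, ‖y n‖ ≤ 1 ∧ v (y n) = v (x n) := fun n => by
    induction n with
    | zero => exact ⟨hx1 0, rfl⟩
    | succ n ih => exact ⟨hg1 n (y n) ih.1 ih.2, hgx n (y n) ih.1 ih.2⟩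
  obtain ⟨Y, hY1, hY⟩ := E.exists_limit U (fun n => (hy n).1)
    fun n => hgE n (y n) (hy n).1 (hy n).2
  refine ⟨Y, by simpa using hY1, ?_⟩
  have hlim1 : Tendsto (fun n => v (x n)) atTop (𝓝 ξ) := by
    rw [tendsto_iff_norm_sub_tendsto_zero]
    have h1 : Tendsto (fun n : ℕ => (1 / 4 : ℝ) ^ n / 2) atTop (𝓝 (0 / 2)) :=
      (tendsto_pow_atTop_nhds_zero_of_lt_one (by norm_num) (by norm_num)).div_const 2
    rw [zero_div] at h1
    refine squeeze_zero (fun _ => norm_nonneg _) (fun n => ?_) h1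
    rw [norm_sub_rev]
    exact (hxξ n).le
  have hlim2 : Tendsto (fun n => v (x n)) atTop (𝓝 (v Y)) := by
    rw [tendsto_iff_norm_sub_tendsto_zero]
    have h1 : Tendsto (fun n : ℕ => √(24 * (1 / 2 : ℝ) ^ n)) atTop (𝓝 √(24 * 0)) :=
      ((tendsto_pow_atTop_nhds_zero_of_lt_one (by norm_num) (by norm_num)).const_mul 24).sqrt
    rw [mul_zero, Real.sqrt_zero] at h1
    refine squeeze_zero (fun _ => norm_nonneg _) (fun n => ?_) h1
    rw [norm_sub_rev, ← (hy n).2, ← map_sub]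
    refine Real.le_sqrt_of_sq_le ?_
    rw [hv, PositiveLinearMap.norm_gnsVec_sq]
    exact hY n
  exact tendsto_nhds_unique hlim2 hlim1

end VonNeumannAlgebra.CentralExpectation

/-! ### The GNS image as a von Neumann algebra -/

namespace PositiveLinearMap

variable {A : Type u} [CStarAlgebra A] [PartialOrder A] [StarOrderedRing A] {f : A →ₚ[ℂ] ℂ}

theorem inner_gnsVec_one (x : A) :
    ⟪f.gnsVec 1, f.gnsStarAlgHom x (f.gnsVec 1)⟫_ℂ = f x := by
  rw [gnsStarAlgHom_gnsVec, mul_one, inner_gnsVec, star_one, one_mul]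

variable (hf : ∀ x y, f (x * y) = f (y * x))

include hf in
theorem gnsStarAlgHom_eq_zero_iff {x : A} : f.gnsStarAlgHom x = 0 ↔ f (star x * x) = 0 := by
  have h0 : f.gnsStarAlgHom x (f.gnsVec 1) = f.gnsVec x := by
    rw [gnsStarAlgHom_gnsVec, mul_one]
  rw [← inner_gnsVec, inner_self_eq_zero, ← h0]
  refine ⟨fun h => by rw [h, _root_.zero_apply], fun h => ?_⟩
  refine f.eq_of_gnsVec_one_eq hf (fun a => (f.gnsRightMul_mul_gnsStarAlgHom hf a x).symm)
    (fun a => by rw [zero_mul, mul_zero]) ?_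
  rw [_root_.zero_apply, h]

variable (hf1 : f 1 = 1) (hcl : IsClosed (f.gnsVec '' Metric.closedBall 0 1))

include hf1 hcl in
/-- Every operator commuting with the right multiplications comes from an algebra element of no
larger norm. -/
theorem exists_gnsStarAlgHom_eq {T : f.GNS →L[ℂ] f.GNS}
    (hT : ∀ a, T * f.gnsRightMul hf a = f.gnsRightMul hf a * T) :
    ∃ x : A, ‖x‖ ≤ ‖T‖ ∧ f.gnsStarAlgHom x = T := by
  rcases eq_or_ne T 0 with rfl | hT0
  · exact ⟨0, by simp, map_zero _⟩
  have hpos : 0 < ‖T‖ := norm_pos_iff.2 hT0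
  set c : ℂ := (‖T‖ : ℂ) with hc
  have hc0 : c ≠ 0 := by simpa [hc] using hT0
  have hcn : ‖c‖ = ‖T‖ := by simp [hc]
  have hcT : ∀ a, (c⁻¹ • T) * f.gnsRightMul hf a = f.gnsRightMul hf a * (c⁻¹ • T) := fun a => by
    rw [smul_mul_assoc, mul_smul_comm, hT]
  have hnorm : ‖c⁻¹ • T‖ ≤ 1 := by
    rw [norm_smul, norm_inv, hcn, inv_mul_cancel₀ hpos.ne']
  -- Closedness of the ball turns approximation into equality, so the rescaled `T` agrees with a
  -- contraction of `A` at the separating vector.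
  have hmem := mem_closure_gnsVec_closedBall hf hf1 hnorm hcT
  rw [hcl.closure_eq] at hmem
  obtain ⟨x, hx1, hx⟩ := hmem
  have hrep : f.gnsStarAlgHom x = c⁻¹ • T :=
    f.eq_of_gnsVec_one_eq hf (fun a => (f.gnsRightMul_mul_gnsStarAlgHom hf a x).symm) hcT
      (by rw [gnsStarAlgHom_gnsVec, mul_one, hx])
  refine ⟨c • x, ?_, by rw [map_smul, hrep, smul_inv_smul₀ hc0]⟩
  rw [norm_smul, hcn]
  exact mul_le_of_le_one_right hpos.le (by simpa using hx1)

-- Being a commutant, the image equals its own bicommutant.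
include hf1 hcl in
theorem coe_range_gnsStarAlgHom : (f.gnsStarAlgHom.range : Set (f.GNS →L[ℂ] f.GNS))
    = Set.centralizer (Set.range (f.gnsRightMul hf)) := by
  ext T
  refine ⟨?_, fun h => ?_⟩
  · rintro ⟨x, rfl⟩ _ ⟨a, rfl⟩
    exact f.gnsRightMul_mul_gnsStarAlgHom hf a x
  · obtain ⟨x, -, rfl⟩ := exists_gnsStarAlgHom_eq hf hf1 hcl fun a => (h _ ⟨a, rfl⟩).symm
    exact ⟨x, rfl⟩

/-- The image of the GNS representation, as a von Neumann algebra. -/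
noncomputable def gnsVonNeumannAlgebra : VonNeumannAlgebra f.GNS where
  toStarSubalgebra := f.gnsStarAlgHom.range
  centralizer_centralizer' := by
    have h := coe_range_gnsStarAlgHom hf hf1 hcl
    change Set.centralizer (Set.centralizer (f.gnsStarAlgHom.range : Set (f.GNS →L[ℂ] f.GNS)))
      = (f.gnsStarAlgHom.range : Set (f.GNS →L[ℂ] f.GNS))
    rw [h, Set.centralizer_centralizer_centralizer]

end PositiveLinearMap

namespace VonNeumannAlgebra

variable {K : Type u} [NormedAddCommGroup K] [InnerProductSpace ℂ K] [CompleteSpace K]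
  (S : VonNeumannAlgebra K) (ξ : K)

/-- The functional `T ↦ ⟪ξ, T ξ⟫`. -/
noncomputable def vectorFunctional : S.toStarSubalgebra →ₗ[ℂ] ℂ where
  toFun T := ⟪ξ, (T : K →L[ℂ] K) ξ⟫_ℂ
  map_add' _ _ := inner_add_right _ _ _
  map_smul' _ _ := inner_smul_right _ _ _

theorem isFaithfulNormalTracialState_of_surjective {A : Type u} [Ring A] [StarRing A] [Algebra ℂ A]
    (f : A → ℂ) (hf1 : f 1 = 1) (hf : ∀ x y, f (x * y) = f (y * x))
    (π : A →⋆ₐ[ℂ] S.toStarSubalgebra) (hπ : Function.Surjective π)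
    (hf0 : ∀ x, f (star x * x) = 0 → π x = 0) (hξ : ∀ x, S.vectorFunctional ξ (π x) = f x) :
    S.IsFaithfulNormalTracialState (S.vectorFunctional ξ) where
  map_nonneg T hT := by
    have h := le_iff_forall_inner_le.1 hT ξ
    rwa [ZeroMemClass.coe_zero, _root_.zero_apply, inner_zero_right] at h
  map_one := by rw [← map_one π, hξ, hf1]
  map_mul_comm T T' := by
    obtain ⟨x, rfl⟩ := hπ T
    obtain ⟨y, rfl⟩ := hπ T'
    rw [← map_mul, ← map_mul, hξ, hξ, hf]
  faithful T h := by
    obtain ⟨x, rfl⟩ := hπ T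
    rw [← map_star, ← map_mul, hξ] at h
    exact hf0 x h
  normal := scottContinuous_inner ξ

end VonNeumannAlgebra

/-- Two surjective `*`-homomorphisms with the same kernel have isomorphic targets. -/
theorem StarAlgEquiv.exists_of_surjective {A B C : Type*} [Ring A] [StarRing A] [Algebra ℂ A]
    [Ring B] [StarRing B] [Algebra ℂ B] [Ring C] [StarRing C] [Algebra ℂ C]
    (q : A →⋆ₐ[ℂ] B) (π : A →⋆ₐ[ℂ] C) (hq : Function.Surjective q) (hπ : Function.Surjective π)
    (h : ∀ x, q x = 0 ↔ π x = 0) : ∃ Φ : B ≃⋆ₐ[ℂ] C, ∀ x, Φ (q x) = π x := by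
  have hinj : ∀ {x y}, q x = q y ↔ π x = π y := fun {x y} => by
    rw [← sub_eq_zero, ← map_sub, h, map_sub, sub_eq_zero]
  let φ : B → C := fun b => π (Function.surjInv hq b)
  have hφ : ∀ x, φ (q x) = π x := fun x => hinj.1 (Function.surjInv_eq hq (q x))
  let Ψ : B →⋆ₐ[ℂ] C :=
    { toFun := φ
      map_one' := by rw [← map_one q, hφ, map_one]
      map_mul' := fun a b => by
        obtain ⟨x, rfl⟩ := hq a
        obtain ⟨y, rfl⟩ := hq b
        rw [← map_mul, hφ, hφ, hφ, map_mul]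
      map_zero' := by rw [← map_zero q, hφ, map_zero]
      map_add' := fun a b => by
        obtain ⟨x, rfl⟩ := hq a
        obtain ⟨y, rfl⟩ := hq b
        rw [← map_add, hφ, hφ, hφ, map_add]
      commutes' := fun c => by rw [← AlgHomClass.commutes q c, hφ, AlgHomClass.commutes]
      map_star' := fun a => by
        obtain ⟨x, rfl⟩ := hq a
        rw [← map_star, hφ, hφ, map_star] }
  refine ⟨StarAlgEquiv.ofBijective Ψ ⟨fun a b hab => ?_, fun c => ?_⟩, hφ⟩
  · obtain ⟨x, rfl⟩ := hq a
    obtain ⟨y, rfl⟩ := hq b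
    refine hinj.2 ?_
    rw [← hφ x, ← hφ y]
    exact hab
  · obtain ⟨x, rfl⟩ := hπ c
    exact ⟨q x, hφ x⟩

/-! ### Transfer to the quotient -/

namespace PositiveLinearMap

variable {A : Type u} [CStarAlgebra A] [PartialOrder A] [StarOrderedRing A] {f : A →ₚ[ℂ] ℂ}
  {Q : Type u} [NormedRing Q] [StarRing Q] [NormedAlgebra ℂ Q]

/-- If the unit ball of a C⋆-algebra is complete in the `2`-norm of a tracial state `f`, then the
quotient by the kernel of `f` is a tracial von Neumann algebra, and the norm of the quotient is
attained. -/
theorem isTracialVonNeumannAlgebra_quotient (hf : ∀ x y, f (x * y) = f (y * x)) (hf1 : f 1 = 1)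
    (hcl : IsClosed (f.gnsVec '' Metric.closedBall 0 1)) (q : A →⋆ₐ[ℂ] Q)
    (hq : Function.Surjective q) (hker : ∀ x, q x = 0 ↔ f (star x * x) = 0)
    (hle : ∀ x, ‖q x‖ ≤ ‖x‖) (hlt : ∀ a, ∀ ε : ℝ, 0 < ε → ∃ x, q x = a ∧ ‖x‖ < ‖a‖ + ε)
    (t : Q →ₗ[ℂ] ℂ) (ht : ∀ x, t (q x) = f x) :
    IsTracialVonNeumannAlgebra Q t ∧ ∀ a, ∃ x, ‖x‖ = ‖a‖ ∧ q x = a := by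
  let S := gnsVonNeumannAlgebra hf hf1 hcl
  let π : A →⋆ₐ[ℂ] S.toStarSubalgebra := f.gnsStarAlgHom.rangeRestrict
  have hπ : ∀ x, ((π x : S.toStarSubalgebra) : f.GNS →L[ℂ] f.GNS) = f.gnsStarAlgHom x :=
    fun x => rfl
  have hπs : Function.Surjective π := f.gnsStarAlgHom.rangeRestrict_surjective
  have hπ0 : ∀ x, π x = 0 ↔ f (star x * x) = 0 := fun x => by
    rw [← gnsStarAlgHom_eq_zero_iff hf, ← hπ, ZeroMemClass.coe_eq_zero]
  have hξ : ∀ x, S.vectorFunctional (f.gnsVec 1) (π x) = f x := fun x => inner_gnsVec_one x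
  obtain ⟨Φ, hΦ⟩ := StarAlgEquiv.exists_of_surjective q π hq hπs fun x => by rw [hker, hπ0]
  -- A lift bounded by the operator norm gives both `‖a‖ ≤ ‖Φ a‖` and, once `Φ` is isometric,
  -- attainment of the quotient norm.
  have hlift : ∀ a, ∃ x, q x = a ∧ ‖x‖ ≤ ‖Φ a‖ := fun a => by
    obtain ⟨z, rfl⟩ := hq a
    obtain ⟨x, hx, hxz⟩ := exists_gnsStarAlgHom_eq hf hf1 hcl
      fun b => (f.gnsRightMul_mul_gnsStarAlgHom hf b z).symm
    refine ⟨x, EquivLike.injective Φ ?_, ?_⟩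
    · rw [hΦ, hΦ]
      exact Subtype.ext hxz
    · rw [hΦ]
      exact hx
  have hΦn : ∀ a, ‖Φ a‖ = ‖a‖ := fun a => by
    refine le_antisymm (le_of_forall_pos_le_add fun ε hε => ?_) ?_
    · obtain ⟨x, rfl, hx⟩ := hlt a ε hε
      rw [hΦ]
      exact (f.norm_gnsStarAlgHom_le x).trans hx.le
    · obtain ⟨x, rfl, hx⟩ := hlift a
      exact (hle x).trans hx
  refine ⟨⟨f.GNS, inferInstance, inferInstance, inferInstance, S, Φ,
    S.vectorFunctional (f.gnsVec 1), AddMonoidHomClass.isometry_of_norm _ hΦn,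
    S.isFaithfulNormalTracialState_of_surjective _ f hf1 hf π hπs (fun x => (hπ0 x).2) hξ,
    fun a => ?_⟩, fun a => ?_⟩
  · obtain ⟨x, rfl⟩ := hq a
    rw [hΦ, hξ, ht]
  · obtain ⟨x, rfl, hx⟩ := hlift a
    rw [hΦn] at hx
    exact ⟨x, le_antisymm hx (hle x), rfl⟩

end PositiveLinearMap

/-! ### The ultrafiber -/

namespace VonNeumannAlgebra.CentralExpectation

variable {H : Type u} [NormedAddCommGroup H] [InnerProductSpace ℂ H] [CompleteSpace H]
  {M N : VonNeumannAlgebra H}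

theorem isTracialVonNeumannAlgebra_ultrafiber (E : CentralExpectation M N)
    (U : N.toStarSubalgebra →ₐ[ℂ] ℂ) :
    IsTracialVonNeumannAlgebra (E.Ultrafiber U) (Ultrafiber.trace E U) ∧
      ∀ a : E.Ultrafiber U, ∃ x : M.toStarSubalgebra, ‖x‖ = ‖a‖ ∧ Ultrafiber.mk E U x = a :=
  letI := toCStarAlgebra M
  letI := toStarOrderedRing M
  PositiveLinearMap.isTracialVonNeumannAlgebra_quotient (E.positiveFunctional_mul_comm U)
    (E.positiveFunctional_one U) (E.isClosed_gnsVec_closedBall U) (Ultrafiber.mk E U)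
    (Ultrafiber.mkₐ_surjective E U) (fun _ => Ultrafiber.mkₐ_eq_zero_iff E U)
    (Ultrafiber.norm_mkₐ_le E U) (fun a _ hε => Ultrafiber.exists_norm_lt E U a hε)
    (Ultrafiber.trace E U) fun _ => rfl

end VonNeumannAlgebra.CentralExpectation

theorem mainTheorem8 {H : Type u} [NormedAddCommGroup H] [InnerProductSpace ℂ H] [CompleteSpace H]
    (M N : VonNeumannAlgebra H) (hM : M.IsFinite)
    (E : VonNeumannAlgebra.CentralExpectation M N) (U : N.toStarSubalgebra →ₐ[ℂ] ℂ) :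
    IsTracialVonNeumannAlgebra (E.Ultrafiber U)
        (VonNeumannAlgebra.CentralExpectation.Ultrafiber.trace E U) ∧
      ∀ a : E.Ultrafiber U, ‖a‖ = 1 →
        ∃ x : M.toStarSubalgebra, ‖x‖ = 1 ∧
          VonNeumannAlgebra.CentralExpectation.Ultrafiber.mk E U x = a := by
  obtain ⟨h1, h2⟩ := E.isTracialVonNeumannAlgebra_ultrafiber U
  refine ⟨h1, fun a ha => ?_⟩
  obtain ⟨x, hx, rfl⟩ := h2 a
  exact ⟨x, hx.trans ha, rfl⟩
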